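/- Fix $q\in(0,1)$ and an integer $k\ge 1$. For $x\in\mathbb N^{m}$ and $y\in\mathbb N^{m}$ or $y\in\mathbb N^{m+1}$ write $x\preceq y$ if $\cdots\le x_2\le y_2\le x_1\le y_1$ (i.e. $x_i\le y_i$ and $y_{i+1}\le x_i$ whenever these entries exist). Let $\mathcal W^+_d$ be the set of nonincreasing vectors in $\mathbb N^{\lfloor d/2\rfloor}$ and $$\mathcal W^+_{k,k+1}=\{(z,y)\in\mathcal W^+_k\times\mathcal W^+_{k+1}: z\preceq y\}.$$ For an integer vector $\lambda$ of length $\lfloor (k+1)/2\rfloor$ let $s_k(\lambda)$ be the number of $(x^1,\dots,x^k)$ with $x^k=\lambda$, $x^{2j}\in\mathbb N^{j}$, $x^{2j-1}\in\mathbb N^{j-1}\times\mathbb Z$, and $|x^{i-1}|\preceq|x^i|$ for $2\le i\le k$ (absolute values taken entrywise). **Model.** Let $\xi^l_i(t/2)$, for integers $t\ge1$, $1\le l\le k$, $1\le i\le\lfloor (l+1)/2\rfloor$, be independent random variables with $\mathbb P(\xi=m)=q^m(1-q)$, $m\in\mathbb N$. Define $X(n)=(X^l_i(n))$ and $X(n+\frac12)$,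 $n\in\mathbb N$, with the same indices $l,i$, by $X(0)=0$ and, row by row for $l=1,\dots,k$, with the convention that terms with upper index $l-1$ and lower index $0$ equal $+\infty$: * at time $n+\frac12$, put $\tilde X^l_i(n)=\min\big(X^l_i(n),X^{l-1}_{i-1}(n+\frac12)\big)$; then $X^l_i(n+\frac12)=\max\big(X^{l-1}_i(n),\tilde X^l_i(n)-\xi^l_i(n+\frac12)\big)$ if $i\le\lfloor l/2\rfloor$, and $X^l_i(n+\frac12)=\tilde X^l_i(n)$ if $l$ is odd and $i=\frac{l+1}2$; * at time $n+1$, if $i\le\lfloor l/2\rfloor$, $X^l_i(n+1)=\min\big(X^{l-1}_{i-1}(n+\frac12),\ \max(X^{l-1}_i(n+1),X^l_i(n+\frac12))+\xi^l_i(n+1)\big)$; if $l$ is odd and $i=\frac{l+1}2$, $X^l_i(n+1)=\min\big(X^{l-1}_{i-1}(n+\frac12),\ |X^l_i(n+\frac12)+\xi^l_i(n+1)-\xi^l_i(n+\frac12)|\big)$. For $n\ge1$ let $Z^k(n)=(X^k_1(n-\frac12),\dots,X^k_{\lfloor k/2\rfloor}(n-\frac12))$ and $Y^k(n)=X^k(n)$.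 **Kernel.** Put $R(x,y)=\frac{1-q}{1+q}(q^{|x-y|}+q^{x+y})$ for $x\in\mathbb N$, $y\ge1$, and $R(x,0)=\frac{1-q}{1+q}q^x$. For $(z,y),(z',y')\in\mathcal W^+_{k,k+1}$ let $$S_k((z,y),(z',y'))=(1-q)^k\frac{s_k(y')}{s_k(y)}\,q^{\sum_{i=1}^r(y_i+y'_i-2z'_i)}\Big(1_{z'_r>0}+\frac{1_{z'_r=0}}{1+q}\Big)1_{z'\preceq y,\,z'\preceq y'}\qquad\text{if }k=2r,$$ $$S_k((z,y),(z',y'))=(1-q)^{k-1}\frac{s_k(y')}{s_k(y)}\,R(y_r,y'_r)\,q^{\sum_{i=1}^{r-1}(y_i+y'_i-2z'_i)}\,1_{z'\preceq y,\,z'\preceq y'}\qquad\text{if }k=2r-1.$$ **Proposition.** $S_k$ is a Markov kernel on $\mathcal W^+_{k,k+1}$, and $(Z^k(n),Y^k(n))_{n\ge1}$ is a Markov chain on $\mathcal W^+_{k,k+1}$ with transition kernel $S_k$: it takes values in $\mathcal W^+_{k,k+1}$, and for all $n\ge1$ and all $w_1,\dots,w_{n+1}\in\mathcal W^+_{k,k+1}$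 such that $A=\{(Z^k(m),Y^k(m))=w_m,\ 1\le m\le n\}$ has positive probability, $$\mathbb P\big((Z^k(n+1),Y^k(n+1))=w_{n+1}\,\big|\,A\big)=S_k(w_n,w_{n+1}).$$ -/

import Mathlib

noncomputable section

namespace OrthGT

/-! ### Interlacing, dominant weights and Gelfand-Tsetlin patterns -/

/-- The interlacing relation `x ⪯ y` between a vector of length `m` and a vector of length `n`
(used for `n = m` and `n = m + 1`).  With `Fin` indices starting at `0` it reads
`⋯ ≤ y 2 ≤ x 1 ≤ y 1 ≤ x 0 ≤ y 0`. -/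
def Interlaced {α : Type*} [LE α] {m n : ℕ} (x : Fin m → α) (y : Fin n → α) : Prop :=
  (∀ (i : Fin m) (j : Fin n), j.val = i.val → x i ≤ y j) ∧
    ∀ (i : Fin m) (j : Fin n), j.val = i.val + 1 → y j ≤ x i

/-- The Gelfand-Tsetlin patterns with `k` rows for the orthogonal group.  Row `i` (`1 ≤ i ≤ k`) has
`⌊(i+1)/2⌋` integer entries; these are nonnegative, except that the last entry of an odd row may
have any sign; the absolute values of consecutive rows interlace.  Row `0` is an empty vector. -/
def GT (k : ℕ) : Set ((i : Fin (k + 1)) → Fin ((i.val + 1) / 2) → ℤ) :=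
  {x | (∀ (i : Fin (k + 1)) (j : Fin ((i.val + 1) / 2)),
          ¬ (Odd i.val ∧ j.val + 1 = (i.val + 1) / 2) → 0 ≤ x i j) ∧
       ∀ i : Fin k, Interlaced (fun j => |x i.castSucc j|) (fun j => |x i.succ j|)}

/-- `s k y` is the number of Gelfand-Tsetlin patterns with `k` rows whose `k`-th row is `y`. -/
def s (k : ℕ) (y : Fin ((k + 1) / 2) → ℤ) : ℕ :=
  Set.ncard {x | x ∈ GT k ∧ x (Fin.last k) = y}

/-- `𝒲⁺_d`: the nonincreasing vectors of `⌊d/2⌋` nonnegative integers. -/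
def Wplus (d : ℕ) : Set (Fin (d / 2) → ℕ) :=
  {x | Antitone x}

/-- Pairs consisting of a vector of length `⌊k/2⌋` and a vector of length `⌊(k+1)/2⌋`. -/
abbrev PairState (k : ℕ) : Type := (Fin (k / 2) → ℕ) × (Fin ((k + 1) / 2) → ℕ)

/-- `𝒲⁺_{k,k+1}`: the pairs `(z, y) ∈ 𝒲⁺_k × 𝒲⁺_{k+1}` with `z ⪯ y`. -/
def WplusPair (k : ℕ) : Set (PairState k) :=
  {p | p.1 ∈ Wplus k ∧ p.2 ∈ Wplus (k + 1) ∧ Interlaced p.1 p.2}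

/-! ### The kernel `S_k` -/

/-- The coordinate `v_j` of a vector, `j` running from `1` to the length (and `0` otherwise). -/
def coord {m : ℕ} (v : Fin m → ℕ) (j : ℕ) : ℕ :=
  if h : 1 ≤ j ∧ j ≤ m then v ⟨j - 1, by omega⟩ else 0

/-- The kernel `R` on `ℕ`, i.e. `R(x, ·)` is the law of `|x + ξ - ξ'|` with `ξ, ξ'` independent
geometric variables with parameter `q`. -/
def R (q : ℝ) (x y : ℕ) : ℝ :=
  if y = 0 then (1 - q) / (1 + q) * q ^ x
  else (1 - q) / (1 + q) * (q ^ ((x : ℤ) - y).natAbs + q ^ (x + y))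

open Classical in
/-- The kernel `S_k((z, y), (z', y'))`, where `p = (z, y)` and `p' = (z', y')`.
For `k = 2r` it is
`(1-q)^k (s_k(y')/s_k(y)) q^{∑_{i=1}^r (y_i+y'_i-2z'_i)} (1_{z'_r>0} + 1_{z'_r=0}/(1+q))`
and for `k = 2r-1` it is
`(1-q)^{k-1} (s_k(y')/s_k(y)) R(y_r,y'_r) q^{∑_{i=1}^{r-1} (y_i+y'_i-2z'_i)}`,
both multiplied by the indicator of `z' ⪯ y` and `z' ⪯ y'`. -/
def S (q : ℝ) (k : ℕ) (p p' : PairState k) : ℝ :=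
  if Interlaced p'.1 p.2 ∧ Interlaced p'.1 p'.2 then
    if Even k then
      (1 - q) ^ k * ((s k (fun j => (p'.2 j : ℤ)) : ℝ) / (s k (fun j => (p.2 j : ℤ)) : ℝ)) *
        q ^ (∑ i ∈ Finset.Icc 1 (k / 2),
          ((coord p.2 i : ℤ) + coord p'.2 i - 2 * coord p'.1 i)) *
        (if 0 < coord p'.1 (k / 2) then 1 else 1 / (1 + q))
    else
      (1 - q) ^ (k - 1) * ((s k (fun j => (p'.2 j : ℤ)) : ℝ) / (s k (fun j => (p.2 j : ℤ)) : ℝ)) *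
        R q (coord p.2 ((k + 1) / 2)) (coord p'.2 ((k + 1) / 2)) *
        q ^ (∑ i ∈ Finset.Icc 1 ((k + 1) / 2 - 1),
          ((coord p.2 i : ℤ) + coord p'.2 i - 2 * coord p'.1 i))
  else 0

/-! ### The particle dynamics

A configuration is a map `x : ℕ → ℕ → ℕ`, where `x l i` is the position of the particle `(l, i)`,
the `i`-th particle of row `l`.  Only the entries with `1 ≤ l` and `1 ≤ i ≤ ⌊(l+1)/2⌋` are
meaningful; the other ones are never used in computing these. -/

/-- Row `l` after the leftward jumps, from the configuration `x` at time `n`; here `a l i` is the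
jump size `ξ_i^l(n+1/2)`.  Particle `(l, i)` is pushed to
`min (X_i^l(n)) (X_{i-1}^{l-1}(n+1/2))` (no pushing when `i = 1`) and then, if `i ≤ ⌊l/2⌋`, jumps
to the left by `ξ_i^l(n+1/2)`, blocked by `X_i^{l-1}(n) ≥ 0` (which makes the truncated subtraction
harmless).  The last particle of an odd row does not jump. -/
def leftRow (x a : ℕ → ℕ → ℕ) : ℕ → ℕ → ℕ
  | 0 => fun _ => 0
  | l + 1 => fun i =>
      let pushed := if i = 1 then x (l + 1) i else min (x (l + 1) i) (leftRow x a l (i - 1))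
      if i ≤ (l + 1) / 2 then max (x l i) (pushed - a (l + 1) i) else pushed

/-- Row `l` after the rightward jumps, from the configuration `x` at time `n+1/2`; here `a l i` is
`ξ_i^l(n+1/2)` and `b l i` is `ξ_i^l(n+1)`.  If `i ≤ ⌊l/2⌋`, particle `(l, i)` is pushed to
`max (X_i^{l-1}(n+1)) (X_i^l(n+1/2))` and then jumps to the right by `ξ_i^l(n+1)`.  The last
particle of an odd row moves to `|X_i^l(n+1/2) + ξ_i^l(n+1) - ξ_i^l(n+1/2)|`.  All of them are
blocked by `X_{i-1}^{l-1}(n+1/2)` (no blocking when `i = 1`). -/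
def rightRow (x a b : ℕ → ℕ → ℕ) : ℕ → ℕ → ℕ
  | 0 => fun _ => 0
  | l + 1 => fun i =>
      let target :=
        if i ≤ (l + 1) / 2 then max (rightRow x a b l i) (x (l + 1) i) + b (l + 1) i
        else ((x (l + 1) i : ℤ) + b (l + 1) i - a (l + 1) i).natAbs
      if i = 1 then target else min (x l (i - 1)) target

/-- The configuration `X(n)` at the integer time `n`, started from `X(0) = 0`, as a function of the
jump sizes; `ξ t l i` is the jump size attached to the particle `(l, i)` and to the time `t / 2`,
`t ≥ 1`, so that `ξ (2n+1)` is used at time `n + 1/2` and `ξ (2n+2)` at time `n + 1`. -/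
def X (ξ : ℕ → ℕ → ℕ → ℕ) : ℕ → ℕ → ℕ → ℕ
  | 0 => fun _ _ => 0
  | n + 1 => rightRow (leftRow (X ξ n) (ξ (2 * n + 1))) (ξ (2 * n + 1)) (ξ (2 * n + 2))

/-- The configuration `X(n + 1/2)`. -/
def Xhalf (ξ : ℕ → ℕ → ℕ → ℕ) (n : ℕ) : ℕ → ℕ → ℕ :=
  leftRow (X ξ n) (ξ (2 * n + 1))

/-- `Z^k(n) = (X_1^k(n - 1/2), …, X_{⌊k/2⌋}^k(n - 1/2))` for `n ≥ 1`, and `Z^k(0) = 0`. -/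
def Z (ξ : ℕ → ℕ → ℕ → ℕ) (k : ℕ) : ℕ → Fin (k / 2) → ℕ
  | 0 => fun _ => 0
  | n + 1 => fun j => Xhalf ξ n k (j.val + 1)

/-- `Y^k(n) = X^k(n)`, the `k`-th row at the integer time `n`. -/
def Y (ξ : ℕ → ℕ → ℕ → ℕ) (k n : ℕ) : Fin ((k + 1) / 2) → ℕ :=
  fun j => X ξ n k (j.val + 1)

/-- The labels `(t, l, i)` of the jump sizes for the model with `k` rows: `t ≥ 1` is twice the time,
`1 ≤ l ≤ k` the row, and `1 ≤ i ≤ ⌊(l+1)/2⌋` the position in the row. -/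
def JumpIndex (k : ℕ) : Set (ℕ × ℕ × ℕ) :=
  {p | 1 ≤ p.1 ∧ (1 ≤ p.2.1 ∧ p.2.1 ≤ k) ∧ (1 ≤ p.2.2 ∧ p.2.2 ≤ (p.2.1 + 1) / 2)}

/-! ### Markov kernels and Markov chains on a countable set -/

/-- `K` is a Markov (stochastic) kernel on the set `E`. -/
def IsMarkovKernelOn {T : Type*} (E : Set T) (K : T → T → ℝ) : Prop :=
  ∀ p ∈ E, (∀ p' ∈ E, 0 ≤ K p p') ∧ HasSum (fun p' : E => K p p') 1

/-- `(W n)_{n ≥ 1}` is a Markov chain on the countable set `E` with transition kernel `K`: it takes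
its values in `E`, and for all `n ≥ 1` and all `w 1, …, w (n+1)` in `E`, the conditional probability
of `W (n+1) = w (n+1)` given `W 1 = w 1, …, W n = w n` is `K (w n) (w (n+1))` whenever the
conditioning event has positive probability. -/
def IsMarkovChainFromOne {Ω T : Type*} [MeasurableSpace Ω] (μ : MeasureTheory.Measure Ω)
    (E : Set T) (K : T → T → ℝ) (W : ℕ → Ω → T) : Prop :=
  (∀ n, 1 ≤ n → ∀ ω, W n ω ∈ E) ∧
    ∀ n, 1 ≤ n → ∀ w : ℕ → T, (∀ m, w m ∈ E) →
      μ {ω | ∀ m, 1 ≤ m → m ≤ n → W m ω = w m} ≠ 0 →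
      ProbabilityTheory.cond μ {ω | ∀ m, 1 ≤ m → m ≤ n → W m ω = w m}
        {ω | W (n + 1) ω = w (n + 1)} = ENNReal.ofReal (K (w n) (w (n + 1)))

end OrthGT

end

/-!
The proof is by induction over the rows, and rests on an intertwining of the kernels `S_k` and
`S_{k+1}`.

Let `Λ_k(y, ·)` (`link`) be the law of row `k`, signs forgotten, of a uniformly chosen pattern with
`k + 1` rows and last row `y`. During one unit of time row `k + 1` is driven by its own jumps and by
the motion `u → v → u'` of row `k`; it moves `y → z → y'` with a probability that is a product over
its particles, `stepProb` (`IsNoise.measure_nextRow`). The intertwining says that if `u` is drawn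
from `Λ_k(y, ·)`, then `(v, u')` from `S_k`, and then `(z, y')` from `stepProb`, the pair `(z, y')`
has law `S_{k+1}(y, ·)` and, given this pair, `u'` has law `Λ_k(y', ·)` (`intertwining`).
By the branching rule for the number of patterns (`count_succ`) the factors `s_k(u)` cancel,
and what is left (`row_sum_eq`) is a sum over the entries of `u` and `v`. On the support of the
summand this is a product of functions of one pair `(u_i, v_i)` each (`even_summand_eq`,
`odd_summand_eq`), and the one-coordinate sums are geometric sums which telescope, because the
blocked particles have an atom at the blocking position (`sum_range_atom`, `sum_range_rightward`).
The sign of the last entry of an odd row and the reflection at the wall need two sums of their own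
(`sum_range_signs`, `sum_range_reflected`).

For the processes, assume that row `j` is Markov with kernel `S_j`. Given the past of row `j`,
the past of row `j + 1` does not depend on the future of row `j`, as it involves other jumps
(`IsNoise.exists_measure_path_inter`). Hence, given the past of row `j + 1` and the position of row
`j`, the next state of the two rows is drawn from `S_j` and `stepProb`
(`IsNoise.measure_joint_step`). Induction over time and the intertwining then show that the
conditional law of row `j` given the past of row `j + 1` is `Λ_j`, and that row `j + 1` is Markov
with kernel `S_{j+1}` (`IsNoise.measure_path_inter_eq`, `IsNoise.rowMarkov`). That `S_k` has total mass `1` follows from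
the intertwining in the same way (`IsNoise.tsum_kern`).
-/

noncomputable section

namespace OrthGT

/-! ### Sums over one coordinate -/

/-- The probability that `max u (x - a) = z` for a geometric variable `a`, when `u ≤ x`. -/
def leftProb (q : ℝ) (u x z : ℕ) : ℝ :=
  if u ≤ z ∧ z ≤ x then q ^ ((x : ℤ) - z) * (if u < z then 1 - q else 1) else 0

/-- The probability that `min c (m + b) = y` for a geometric variable `b`, when `m ≤ c`. -/
def rightProb (q : ℝ) (m c y : ℕ) : ℝ :=
  if m ≤ y ∧ y ≤ c then q ^ ((y : ℤ) - m) * (if y < c then 1 - q else 1) else 0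

/-- The probability that `min c |x + b - a| = y` for independent geometric variables `a` and `b`,
when `x ≤ c`. -/
def reflProb (q : ℝ) (x c y : ℕ) : ℝ :=
  if y < c then R q x y
  else if y = c then (if c = 0 then 1 else (q ^ ((c : ℤ) - x) + q ^ ((c : ℤ) + x)) / (1 + q)) else 0

/-- The number of signs that the last entry `u` of an odd row of a pattern may carry. -/
def signs (u : ℕ) : ℕ := if u = 0 then 1 else 2

/-- The factor of `S_{2r}` at the wall, as a function of `z'_r`. -/
def wallFactor (q : ℝ) (v : ℕ) : ℝ := if 0 < v then 1 else 1 / (1 + q)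

/-- A geometric sum with an atom at its upper end `z` telescopes to the term at its lower end. -/
theorem sum_range_atom (q : ℝ) (lo z : ℕ) :
    ∑ u ∈ Finset.range (z + 1),
        (if lo ≤ u ∧ u ≤ z then q ^ (u : ℤ) * (if u < z then 1 - q else 1) else 0)
      = if lo ≤ z then q ^ (lo : ℤ) else 0 := by
  have h1 : ∀ n, ∑ u ∈ Finset.range n, (if lo ≤ u then q ^ u * (1 - q) else 0)
      = if lo ≤ n then q ^ lo - q ^ n else 0 := by
    intro n
    induction n with
    | zero =>
      rcases Nat.eq_zero_or_pos lo with h | h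
      · simp [h]
      · simp [h.ne']
    | succ n ih =>
      rw [Finset.sum_range_succ, ih]
      rcases Nat.lt_trichotomy lo (n + 1) with h | h | h
      · rw [if_pos (by omega), if_pos (by omega), if_pos (by omega)]; ring
      · rw [if_neg (by omega), if_neg (by omega), if_pos (by omega), h]; ring
      · rw [if_neg (by omega), if_neg (by omega), if_neg (by omega)]; ring
  rw [Finset.sum_range_succ]
  have h2 : ∀ u ∈ Finset.range z, (if lo ≤ u ∧ u ≤ z then q ^ (u : ℤ) * (if u < z then 1 - q else 1)
      else 0) = (if lo ≤ u then q ^ u * (1 - q) else 0) := by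
    intro u hu
    have := Finset.mem_range.1 hu
    simp [this, this.le]
  rw [Finset.sum_congr rfl h2, h1]
  by_cases h : lo ≤ z <;> simp [h]

theorem sum_range_le_ite (u' z : ℕ) (f : ℕ → ℝ) :
    ∑ v ∈ Finset.range (z + 1), (if v ≤ u' then f v else 0) =
      ∑ v ∈ Finset.range (min u' z + 1), f v := by
  rw [← Finset.sum_filter]
  congr 1
  ext v
  simp only [Finset.mem_filter, Finset.mem_range]
  omega

/-- The sum over the position `v` of a particle of row `k - 1` at the intermediate time, seen from
a neighbour of row `k` that makes two ordinary jumps: the atom at the blocking position makes it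
telescope. -/
theorem sum_range_rightward {q : ℝ} (hq : 0 < q) (b c M : ℕ) :
    ∑ v ∈ Finset.range (M + 1), q ^ ((max b v : ℤ) - 2 * v) *
      (if c ≤ v then q ^ (min b v : ℤ) * (if c < v then 1 - q else 1) else 0) =
      if c ≤ M then q ^ ((b : ℤ) - M) else 0 := by
  have key : ∀ v : ℕ, q ^ ((max b v : ℤ) - 2 * v) * q ^ (min b v : ℤ) = q ^ ((b : ℤ) - v) := by
    intro v
    rw [← zpow_add₀ hq.ne']
    congr 1
    have := max_add_min (b : ℤ) v
    linarith
  induction M with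
  | zero =>
    rcases Nat.eq_zero_or_pos c with h | h
    · have := key 0
      simp [h] at this ⊢
    · simp [h.ne']
  | succ M ih =>
    rw [Finset.sum_range_succ, ih]
    rcases Nat.lt_trichotomy c (M + 1) with h | h | h
    · rw [if_pos (by omega), if_pos (by omega), if_pos h, if_pos h.le, ← mul_assoc, key]
      have : q ^ ((b : ℤ) - M) = q ^ ((b : ℤ) - (M + 1 : ℕ)) * q := by
        rw [← zpow_add_one₀ hq.ne']; congr 1; push_cast; ring
      rw [this]; ring
    · rw [if_neg (by omega), if_pos (by omega), if_neg (by omega), if_pos (by omega), ← mul_assoc,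
        key]
      ring
    · rw [if_neg (by omega), if_neg (by omega), if_neg (by omega)]; ring

theorem R_of_le (q : ℝ) {x y : ℕ} (h : y ≤ x) (hy : y ≠ 0) :
    R q x y = (1 - q) / (1 + q) * (q ^ ((x : ℤ) - y) + q ^ ((x : ℤ) + y)) := by
  rw [R, if_neg hy, ← zpow_natCast, ← zpow_natCast]
  congr 4
  omega

theorem R_of_ge (q : ℝ) {x y : ℕ} (h : x ≤ y) (hy : y ≠ 0) :
    R q x y = (1 - q) / (1 + q) * (q ^ ((y : ℤ) - x) + q ^ ((x : ℤ) + y)) := by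
  rw [R, if_neg hy, ← zpow_natCast, ← zpow_natCast]
  congr 4
  omega

/-- Above its target `c`, the starting point of `R` can be moved at the cost of a power of `q`. -/
theorem zpow_mul_R {q : ℝ} (hq : 0 < q) {b v c : ℕ} (h : c ≤ v) :
    q ^ ((max b v : ℤ) - v) * R q (min b v) c = R q b c := by
  rcases le_total b v with hb | hb
  · simp [hb]
  · rw [min_eq_right hb, max_eq_left (by exact_mod_cast hb)]
    rcases Nat.eq_zero_or_pos c with rfl | hc
    · simp only [R, if_true, ← zpow_natCast]
      rw [mul_left_comm, ← zpow_add₀ hq.ne']; congr 2; ring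
    · rw [R_of_le q h hc.ne', R_of_le q (h.trans hb) hc.ne', mul_left_comm, mul_add,
        ← zpow_add₀ hq.ne', ← zpow_add₀ hq.ne']
      congr 3 <;> ring

/-- The sum over the position `v` of the last particle of an even row at the intermediate time, seen
from the reflected particle of the next row. -/
theorem sum_range_reflected {q : ℝ} (hq : 0 < q) (b c M : ℕ) :
    (1 - q) * ∑ v ∈ Finset.range (M + 1), q ^ ((max b v : ℤ) - 2 * v) *
      (wallFactor q v * reflProb q (min b v) v c) =
        if c ≤ M then R q b c * q ^ (-(M : ℤ)) else 0 := by
  have h1q : (1 + q) ≠ 0 := by positivity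
  -- The term `v = c`, in which the reflected particle ends at its blocking position.
  have atom : ∀ v : ℕ, (1 - q) * (q ^ ((max b v : ℤ) - 2 * v) *
      (wallFactor q v * reflProb q (min b v) v v)) = R q b v * q ^ (-(v : ℤ)) := by
    intro v
    rcases Nat.eq_zero_or_pos v with rfl | hv
    · simp [wallFactor, reflProb, R]; field_simp
    · rw [wallFactor, if_pos hv, reflProb, if_neg (lt_irrefl _), if_pos rfl, if_neg hv.ne']
      rcases le_total b v with hb | hb
      · rw [min_eq_left hb, max_eq_right (by exact_mod_cast hb), R_of_ge q hb hv.ne']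
        rw [show ((v : ℤ) - 2 * v) = -v by ring, add_comm (v : ℤ) b]
        field_simp
      · rw [min_eq_right hb, max_eq_left (by exact_mod_cast hb), R_of_le q hb hv.ne']
        have e1 : q ^ ((b : ℤ) - v) = q ^ ((b : ℤ) - 2 * v) * q ^ (v : ℤ) := by
          rw [← zpow_add₀ hq.ne']; congr 1; ring
        have e2 : q ^ ((b : ℤ) + v) = q ^ ((b : ℤ) - 2 * v) * (q ^ (v : ℤ) * q ^ ((v : ℤ) + v)) := by
          rw [← zpow_add₀ hq.ne', ← zpow_add₀ hq.ne']; congr 1; ring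
        rw [e1, e2, zpow_neg]
        field_simp
        simp
  induction M with
  | zero =>
    rw [zero_add, Finset.sum_range_one]
    rcases Nat.eq_zero_or_pos c with rfl | h
    · rw [atom 0]; simp
    · rw [if_neg (by omega), reflProb, if_neg (by omega), if_neg (by omega)]; ring
  | succ M ih =>
    rw [Finset.sum_range_succ, mul_add, ih]
    rcases Nat.lt_trichotomy c (M + 1) with h | h | h
    · rw [if_pos (by omega), if_pos (by omega), wallFactor, if_pos (by omega), reflProb, if_pos h,
        ← zpow_mul_R hq (b := b) h.le]
      have e1 : q ^ ((max b (M + 1 : ℕ) : ℤ) - 2 * (M + 1 : ℕ)) =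
          q ^ ((max b (M + 1 : ℕ) : ℤ) - (M + 1 : ℕ)) * q ^ (-((M + 1 : ℕ) : ℤ)) := by
        rw [← zpow_add₀ hq.ne']; congr 1; ring
      have e2 : q ^ (-(M : ℤ)) = q ^ (-((M + 1 : ℕ) : ℤ)) * q := by
        rw [← zpow_add_one₀ hq.ne']; congr 1; push_cast; ring
      rw [e1, e2]; ring
    · rw [if_neg (by omega), if_pos (by omega), h, atom]; ring
    · rw [if_neg (by omega), if_neg (by omega), reflProb, if_neg (by omega), if_neg (by omega)]; ring

/-- The sum over the last entry `u` of an odd row, which counts with its possible signs and moves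
according to `R`; the last factor is the atom of the last particle of the next row. -/
theorem sum_range_signs {q : ℝ} (hq : 0 < q) (z u' : ℕ) :
    ∑ u ∈ Finset.range (z + 1), (signs u : ℝ) * R q u u' * (if u < z then 1 - q else 1) =
      (1 - q) * signs u' * wallFactor q z * q ^ ((max u' z : ℤ) - z) := by
  have h1q : (1 + q) ≠ 0 := by positivity
  -- The atom at `u = z` separated from the other terms, the identity follows by induction on `z`.
  have main : ∀ z : ℕ, (1 - q) * ∑ u ∈ Finset.range z, (signs u : ℝ) * R q u u'
      + (signs z : ℝ) * R q z u' =
        (1 - q) * signs u' * wallFactor q z * q ^ ((max u' z : ℤ) - z) := by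
    intro z
    induction z with
    | zero =>
      rcases Nat.eq_zero_or_pos u' with rfl | h
      · simp [signs, R, wallFactor]; field_simp
      · simp [signs, R, wallFactor, h.ne']; field_simp; ring
    | succ z ih =>
      have hs : (1 - q) * ∑ u ∈ Finset.range z, (signs u : ℝ) * R q u u' =
        (1 - q) * signs u' * wallFactor q z * q ^ ((max u' z : ℤ) - z)
          - (signs z : ℝ) * R q z u' := by linarith
      rw [Finset.sum_range_succ, mul_add, hs, wallFactor, wallFactor, if_pos (Nat.succ_pos z)]
      rcases Nat.eq_zero_or_pos u' with rfl | h
      · rw [max_eq_right (by exact_mod_cast Nat.zero_le z),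
          max_eq_right (by exact_mod_cast Nat.zero_le (z + 1))]
        rcases Nat.eq_zero_or_pos z with rfl | hz
        · simp [signs, R]; field_simp; ring
        · simp [signs, R, hz.ne', hz]; field_simp; ring
      · have hsz : (signs (z + 1) : ℝ) = 2 := by simp [signs]
        have hsu : (signs u' : ℝ) = 2 := by simp [signs, h.ne']
        rw [hsz, hsu]
        rcases Nat.lt_or_ge z u' with hz | hz
        · rw [R_of_ge q hz.le h.ne', R_of_ge q hz h.ne', max_eq_left (by exact_mod_cast hz.le),
            max_eq_left (by exact_mod_cast hz)]
          have e1 : q ^ ((u' : ℤ) - z) = q ^ ((u' : ℤ) - (z + 1 : ℕ)) * q := by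
            rw [← zpow_add_one₀ hq.ne']; congr 1; push_cast; ring
          have e2 : q ^ (((z + 1 : ℕ) : ℤ) + u') = q ^ ((z : ℤ) + u') * q := by
            rw [← zpow_add_one₀ hq.ne']; congr 1; push_cast; ring
          rcases Nat.eq_zero_or_pos z with rfl | hz
          · have e3 : q ^ (((0 : ℕ) : ℤ) + u') = q ^ ((u' : ℤ) - (0 + 1 : ℕ)) * q := by
              rw [← zpow_add_one₀ hq.ne']; congr 1; push_cast; ring
            rw [e2, e1, e3]; simp [signs]; field_simp; ring
          · rw [e1, e2, if_pos hz]; simp [signs, hz.ne']; field_simp; ring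
        · have hz0 : 0 < z := by omega
          rw [R_of_le q hz h.ne', R_of_le q (by omega) h.ne', max_eq_right (by exact_mod_cast hz),
            max_eq_right (by push_cast; omega), if_pos hz0]
          have e1 : q ^ (((z + 1 : ℕ) : ℤ) - u') = q ^ ((z : ℤ) - u') * q := by
            rw [← zpow_add_one₀ hq.ne']; congr 1; push_cast; ring
          have e2 : q ^ (((z + 1 : ℕ) : ℤ) + u') = q ^ ((z : ℤ) + u') * q := by
            rw [← zpow_add_one₀ hq.ne']; congr 1; push_cast; ring
          rw [e1, e2]; simp [signs, hz0.ne']; field_simp; ring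
  rw [← main, Finset.sum_range_succ, Finset.mul_sum]
  congr 1
  · apply Finset.sum_congr rfl
    intro u hu
    rw [if_pos (Finset.mem_range.1 hu)]; ring
  · simp

/-! ### The one-step intertwining of two consecutive rows -/

theorem coord_succ {m : ℕ} (v : Fin m → ℕ) (i : Fin m) : coord v (i.val + 1) = v i := by
  rw [coord, dif_pos ⟨by omega, by omega⟩]
  rfl

theorem coord_castSucc {m : ℕ} (v : Fin (m + 1) → ℕ) (i : Fin m) :
    coord v (i.val + 1) = v i.castSucc :=
  coord_succ v i.castSucc

theorem coord_last {m : ℕ} (v : Fin (m + 1) → ℕ) : coord v (m + 1) = v (Fin.last m) :=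
  coord_succ v (Fin.last m)

theorem coord_one {m : ℕ} (v : Fin (m + 1) → ℕ) : coord v 1 = v 0 :=
  coord_succ v 0

/-- The kernel `S_k` without the factor `s_k(y') / s_k(y)`, for vectors `z` of length `m` and
`y, y'` of length `n`, where `n = m` if `k` is even and `n = m + 1` if `k` is odd.  For `m = n = 0`
it equals `1`, which makes row `0` a legitimate start of the induction over the rows. -/
def rowKernel (q : ℝ) {m n : ℕ} (z : Fin m → ℕ) (y y' : Fin n → ℕ) : ℝ :=
  open Classical in
  if Interlaced z y ∧ Interlaced z y' then
    (1 - q) ^ (2 * m) *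
      (∏ i : Fin m, q ^ ((coord y (i + 1) : ℤ) + coord y' (i + 1) - 2 * z i)) *
      (if n = m then (if m = 0 then 1 else wallFactor q (coord z m))
        else R q (coord y n) (coord y' n))
  else 0

/-- The position blocking the particle `i + 1` of a row that moves from `y` to `y'`, when the
previous row is in `v` at the intermediate time.  Nothing blocks the first particle; a value beyond
`y` and `y'` has the same effect. -/
def barrier {p n : ℕ} (v : Fin p → ℕ) (y y' : Fin n → ℕ) (i : ℕ) : ℕ :=
  if i = 0 then coord y 1 + coord y' 1 + 1 else coord v i

/-- The probability that a row jumps from `y` to `z` and then to `y'`, when the previous row moves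
from `u` to `v` and then to `u'`; a factor for each particle. -/
def stepProb (q : ℝ) {p d n : ℕ} (v : Fin p → ℕ) (u u' z : Fin d → ℕ) (y y' : Fin n → ℕ) : ℝ :=
  (∏ i : Fin d, leftProb q (u i) (min (coord y (i + 1)) (barrier v y y' i)) (z i) *
    rightProb q (max (u' i) (z i)) (barrier v y y' i) (coord y' (i + 1))) *
  (if d = n then 1
    else reflProb q (min (coord y n) (barrier v y y' (n - 1))) (barrier v y y' (n - 1)) (coord y' n))

/-- The number of sign choices in a row `u` of length `d` of a pattern whose number of
sign-constrained entries is `p`. -/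
def signWeight (p : ℕ) {d : ℕ} (u : Fin d → ℕ) : ℕ := if d = p then 1 else signs (coord u d)

theorem interlaced_succ {p : ℕ} {x : Fin p → ℕ} {y : Fin (p + 1) → ℕ} :
    Interlaced x y ↔ ∀ i : Fin p, x i ≤ y i.castSucc ∧ y i.succ ≤ x i := by
  constructor
  · intro h i
    exact ⟨h.1 i i.castSucc rfl, h.2 i i.succ rfl⟩
  · intro h
    refine ⟨fun i j hij => ?_, fun i j hij => ?_⟩
    · rw [show j = i.castSucc from Fin.ext hij]; exact (h i).1
    · rw [show j = i.succ from Fin.ext hij]; exact (h i).2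

theorem interlaced_self {p : ℕ} {x y : Fin (p + 1) → ℕ} :
    Interlaced x y ↔ (∀ i, x i ≤ y i) ∧ ∀ i : Fin p, y i.succ ≤ x i.castSucc := by
  constructor
  · intro h
    exact ⟨fun i => h.1 i i rfl, fun i => h.2 i.castSucc i.succ rfl⟩
  · intro h
    refine ⟨fun i j hij => ?_, fun i j hij => ?_⟩
    · rw [show j = i from Fin.ext hij]; exact h.1 i
    · have hi : i.val < p := by omega
      rw [show j = (⟨i, hi⟩ : Fin p).succ from Fin.ext hij]; exact h.2 ⟨i, hi⟩

/-- Summing over both positions `u ≥ v` of a particle of row `k - 1`, in the case of a particle all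
of whose neighbours make ordinary jumps. -/
theorem sum_range_pair {q : ℝ} (hq : 0 < q) (b c u' z : ℕ) :
    ∑ v ∈ Finset.range (z + 1), (if v ≤ u' ∧ c ≤ v then q ^ (-2 * (v : ℤ)) *
        (q ^ (min b v : ℤ) * (if c < v then 1 - q else 1)) else 0) *
      (if max b v ≤ z then q ^ ((max b v : ℕ) : ℤ) else 0) =
    if b ≤ z ∧ c ≤ min u' z then q ^ ((b : ℤ) - (min u' z : ℕ)) else 0 := by
  by_cases hb : b ≤ z
  · have h1 := sum_range_rightward hq b c (min u' z)
    rw [← sum_range_le_ite] at h1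
    simp only [hb, true_and]
    rw [← h1]
    apply Finset.sum_congr rfl
    intro v hv
    have hv' : max b v ≤ z := by
      have := Finset.mem_range.1 hv
      omega
    rw [if_pos hv']
    by_cases h : v ≤ u'
    · by_cases h' : c ≤ v
      · rw [if_pos ⟨h, h'⟩, if_pos h, if_pos h', mul_right_comm, ← zpow_add₀ hq.ne']
        congr 2; push_cast; ring
      · simp [h']
    · simp [h]
  · rw [if_neg (by tauto)]
    apply Finset.sum_eq_zero
    intro v _
    rw [if_neg (by omega : ¬ max b v ≤ z), mul_zero]

theorem barrier_zero {p n : ℕ} (v : Fin p → ℕ) (y y' : Fin (n + 1) → ℕ) :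
    barrier v y y' 0 = y 0 + y' 0 + 1 := by
  rw [barrier, if_pos rfl, coord_one, coord_one]

theorem barrier_succ {p n : ℕ} (v : Fin p → ℕ) (y y' : Fin n → ℕ) (i : Fin p) :
    barrier v y y' (i + 1) = v i := by
  rw [barrier, if_neg (by omega), coord_succ]

section EvenRow

variable {q : ℝ} {p : ℕ} (v : Fin p → ℕ) (u u' z y y' : Fin (p + 1) → ℕ)

open Classical in
/-- The summand of the intertwining for a row `u` of odd index and a next row of the same length: a
factor independent of `u` and `v`, times factors that involve one index of `u` and `v` each. -/
theorem even_summand_eq (hq : 0 < q) :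
    (if Interlaced u y then (signWeight p u : ℝ) else 0) * rowKernel q v u u' *
      stepProb q v u u' z y y' =
    (if ∀ j, z j ≤ y j ∧ u' j ≤ y' j ∧ z j ≤ y' j then
      (1 - q) ^ (2 * p + 1) * (∏ i : Fin p, q ^ (u' i.castSucc : ℤ)) *
        (∏ j, q ^ (z j : ℤ))⁻¹ * (∏ j, q ^ ((y' j : ℤ) - (max (u' j) (z j) : ℕ))) * q ^ (y 0 : ℤ)
      else 0) *
    ((∏ i : Fin p, if v i ≤ u' i.castSucc ∧ y' i.succ ≤ v i then q ^ (-2 * (v i : ℤ)) *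
        (q ^ (min (y i.succ) (v i) : ℤ) * (if y' i.succ < v i then 1 - q else 1)) else 0) *
     ((∏ i : Fin p, if max (y i.succ) (v i) ≤ u i.castSucc ∧ u i.castSucc ≤ z i.castSucc then
        q ^ (u i.castSucc : ℤ) * (if u i.castSucc < z i.castSucc then 1 - q else 1) else 0) *
      (if u (Fin.last p) ≤ z (Fin.last p) then (signs (u (Fin.last p)) : ℝ) *
        R q (u (Fin.last p)) (u' (Fin.last p)) *
        (if u (Fin.last p) < z (Fin.last p) then 1 - q else 1) else 0))) := by
  have hq' := hq.ne'
  by_cases hP : (∀ j, u j ≤ z j ∧ z j ≤ y j ∧ u' j ≤ y' j ∧ z j ≤ y' j) ∧ ∀ i : Fin p,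
      y i.succ ≤ u i.castSucc ∧ v i ≤ u i.castSucc ∧ v i ≤ u' i.castSucc ∧ y' i.succ ≤ v i
  · obtain ⟨h1, h2⟩ := hP
    have hV : ∀ j : Fin (p + 1), z j ≤ barrier v y y' j ∧ y' j ≤ barrier v y y' j := by
      intro j
      induction j using Fin.cases with
      | zero => have := h1 0; rw [Fin.val_zero, barrier_zero]; omega
      | succ i => have := h1 i.succ; have := h2 i; rw [Fin.val_succ, barrier_succ]; omega
    have huy : Interlaced u y := interlaced_self.2
      ⟨fun j => (h1 j).1.trans (h1 j).2.1, fun i => (h2 i).1⟩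
    have hvu : Interlaced v u ∧ Interlaced v u' := by
      refine ⟨interlaced_succ.2 fun i => ?_, interlaced_succ.2 fun i => ?_⟩ <;>
      · have := h1 i.succ; have := h2 i; omega
    -- On the common support, each factor is a product of powers of `q` and atoms.
    have eL : ∀ j : Fin (p + 1), leftProb q (u j) (min (coord y (j + 1)) (barrier v y y' j)) (z j) *
        rightProb q (max (u' j) (z j)) (barrier v y y' j) (coord y' (j + 1)) =
        q ^ ((min (y j) (barrier v y y' j) : ℕ) : ℤ) * (q ^ (z j : ℤ))⁻¹ *
          (if u j < z j then 1 - q else 1) * (q ^ ((y' j : ℤ) - (max (u' j) (z j) : ℕ)) *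
          (if y' j < barrier v y y' j then 1 - q else 1)) := by
      intro j
      rw [coord_succ, coord_succ, leftProb, rightProb, if_pos ⟨(h1 j).1, le_min (h1 j).2.1 (hV j).1⟩,
        if_pos (show max (u' j) (z j) ≤ y' j ∧ _ from
          ⟨max_le (h1 j).2.2.1 (h1 j).2.2.2, (hV j).2⟩), zpow_sub₀ hq', div_eq_mul_inv]
    have eMin : ∏ j : Fin (p + 1), q ^ ((min (y j) (barrier v y y' j) : ℕ) : ℤ) =
        q ^ (y 0 : ℤ) * ∏ i : Fin p, q ^ (min (y i.succ) (v i) : ℤ) := by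
      rw [Fin.prod_univ_succ]
      simp only [Fin.val_zero, barrier_zero, Fin.val_succ, barrier_succ]
      rw [min_eq_left (by omega)]
      push_cast
      rfl
    have eAtom : ∏ j : Fin (p + 1), (if y' j < barrier v y y' j then 1 - q else 1) =
        (1 - q) * ∏ i : Fin p, (if y' i.succ < v i then 1 - q else 1) := by
      rw [Fin.prod_univ_succ]
      simp only [Fin.val_zero, barrier_zero, Fin.val_succ, barrier_succ]
      rw [if_pos (by omega)]
    have eSgn : signWeight p u = signs (u (Fin.last p)) := by
      rw [signWeight, if_neg (by omega), coord_last]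
    have eK : rowKernel q v u u' = (1 - q) ^ (2 * p) *
        ((∏ i : Fin p, q ^ (u i.castSucc : ℤ)) * (∏ i : Fin p, q ^ (u' i.castSucc : ℤ)) *
          ∏ i : Fin p, q ^ (-2 * (v i : ℤ))) * R q (u (Fin.last p)) (u' (Fin.last p)) := by
      rw [rowKernel, if_pos hvu, if_neg (by omega), coord_last, coord_last,
        ← Finset.prod_mul_distrib, ← Finset.prod_mul_distrib]
      congr 2
      apply Finset.prod_congr rfl
      intro i _
      rw [coord_castSucc, coord_castSucc, ← zpow_add₀ hq', ← zpow_add₀ hq']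
      ring_nf
    have eA : ∀ i : Fin p, (if v i ≤ u' i.castSucc ∧ y' i.succ ≤ v i then q ^ (-2 * (v i : ℤ)) *
        (q ^ (min (y i.succ) (v i) : ℤ) * (if y' i.succ < v i then 1 - q else 1)) else 0) =
        q ^ (-2 * (v i : ℤ)) *
        (q ^ (min (y i.succ) (v i) : ℤ) * (if y' i.succ < v i then 1 - q else 1)) :=
      fun i => if_pos ⟨(h2 i).2.2.1, (h2 i).2.2.2⟩
    have eB : ∀ i : Fin p, (if max (y i.succ) (v i) ≤ u i.castSucc ∧ u i.castSucc ≤ z i.castSucc then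
        q ^ (u i.castSucc : ℤ) * (if u i.castSucc < z i.castSucc then 1 - q else 1) else 0) =
        q ^ (u i.castSucc : ℤ) * (if u i.castSucc < z i.castSucc then 1 - q else 1) :=
      fun i => if_pos ⟨max_le (h2 i).1 (h2 i).2.1, (h1 _).1⟩
    rw [if_pos huy, stepProb, if_pos rfl, eK, eSgn, if_pos fun j => (h1 j).2, if_pos (h1 _).1]
    simp only [eL, eA, eB, Finset.prod_mul_distrib, Finset.prod_inv_distrib]
    rw [eMin, eAtom, Fin.prod_univ_castSucc (fun j => if u j < z j then 1 - q else 1)]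
    ring
  -- Off this set of `u` and `v`, both sides vanish.
  · trans 0
    · by_contra hne
      apply hP
      simp only [mul_ne_zero_iff, stepProb, rowKernel, leftProb, rightProb, Finset.prod_ne_zero_iff,
        ite_ne_right_iff, interlaced_self, interlaced_succ, coord_succ] at hne
      obtain ⟨⟨⟨⟨h1, h2⟩, -⟩, ⟨⟨h3, h4⟩, -⟩⟩, ⟨h5, -⟩⟩ := hne
      have h6 : ∀ j, (u j ≤ z j ∧ z j ≤ min (y j) (barrier v y y' j)) ∧
          max (u' j) (z j) ≤ y' j ∧ y' j ≤ barrier v y y' j := fun j =>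
        ⟨(h5 j (Finset.mem_univ j)).1.1, (h5 j (Finset.mem_univ j)).2.1⟩
      refine ⟨fun j => ?_, fun i => ?_⟩
      · have := h6 j
        omega
      · have h7 := h6 i.succ
        rw [Fin.val_succ, barrier_succ] at h7
        exact ⟨h2 i, (h3 i).1, (h4 i).1, h7.2.2⟩
    · symm
      by_contra hne
      apply hP
      simp only [mul_ne_zero_iff, Finset.prod_ne_zero_iff, ite_ne_right_iff] at hne
      obtain ⟨⟨h1, -⟩, h2, h3, ⟨h4, -⟩⟩ := hne
      refine ⟨fun j => ⟨?_, h1 j⟩, fun i => ?_⟩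
      · induction j using Fin.lastCases with
        | last => exact h4
        | cast i => exact (h3 i (Finset.mem_univ i)).1.2
      · have := (h3 i (Finset.mem_univ i)).1
        have := (h2 i (Finset.mem_univ i)).1
        omega

open Classical in
/-- The one-step intertwining when the next row has an even index, hence no reflected particle. -/
theorem even_sum_eq (hq : 0 < q) :
    ∑ u ∈ Fintype.piFinset (fun i => Finset.range (z i + 1)),
      ∑ v ∈ Fintype.piFinset (fun i : Fin p => Finset.range (z i.castSucc + 1)),
        (if Interlaced u y then (signWeight p u : ℝ) else 0) * rowKernel q v u u' *
          stepProb q v u u' z y y' =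
    rowKernel q z y y' * (if Interlaced u' y' then (signWeight p u' : ℝ) else 0) := by
  have hq' := hq.ne'
  rw [Finset.sum_comm]
  simp only [even_summand_eq _ _ _ _ _ _ hq, ← Finset.mul_sum]
  -- The sum over `u`, coordinate by coordinate.
  have hu : ∀ v : Fin p → ℕ, ∑ u ∈ Fintype.piFinset (fun i => Finset.range (z i + 1)),
      ((∏ i : Fin p, if max (y i.succ) (v i) ≤ u i.castSucc ∧ u i.castSucc ≤ z i.castSucc then
        q ^ (u i.castSucc : ℤ) * (if u i.castSucc < z i.castSucc then 1 - q else 1) else 0) *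
      (if u (Fin.last p) ≤ z (Fin.last p) then (signs (u (Fin.last p)) : ℝ) *
        R q (u (Fin.last p)) (u' (Fin.last p)) *
        (if u (Fin.last p) < z (Fin.last p) then 1 - q else 1) else 0)) =
      (∏ i : Fin p, if max (y i.succ) (v i) ≤ z i.castSucc then
        q ^ ((max (y i.succ) (v i) : ℕ) : ℤ) else 0) *
      ((1 - q) * signs (u' (Fin.last p)) * wallFactor q (z (Fin.last p)) *
        q ^ ((max (u' (Fin.last p)) (z (Fin.last p)) : ℤ) - z (Fin.last p))) := by
    intro v
    have h := Finset.prod_univ_sum (fun j => Finset.range (z j + 1))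
      (fun (j : Fin (p + 1)) (x : ℕ) => (Fin.lastCases (motive := fun _ => ℕ → ℝ)
        (fun x => if x ≤ z (Fin.last p) then (signs x : ℝ) * R q x (u' (Fin.last p)) *
          (if x < z (Fin.last p) then 1 - q else 1) else 0)
        (fun i x => if max (y i.succ) (v i) ≤ x ∧ x ≤ z i.castSucc then
          q ^ (x : ℤ) * (if x < z i.castSucc then 1 - q else 1) else 0) j) x)
    simp only [Fin.prod_univ_castSucc, Fin.lastCases_castSucc, Fin.lastCases_last,
      sum_range_atom, sum_range_le_ite, min_self, sum_range_signs hq] at h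
    exact h.symm
  simp only [hu, ← mul_assoc, ← Finset.sum_mul, ← Finset.prod_mul_distrib]
  -- The sum over `v`, coordinate by coordinate.
  have hv := Finset.prod_univ_sum (fun i : Fin p => Finset.range (z i.castSucc + 1))
    (fun (i : Fin p) (x : ℕ) => (if x ≤ u' i.castSucc ∧ y' i.succ ≤ x then q ^ (-2 * (x : ℤ)) *
        (q ^ (min (y i.succ) x : ℤ) * (if y' i.succ < x then 1 - q else 1)) else 0) *
      (if max (y i.succ) x ≤ z i.castSucc then q ^ ((max (y i.succ) x : ℕ) : ℤ) else 0))
  rw [Finset.prod_congr rfl fun i _ => sum_range_pair hq _ _ _ _] at hv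
  simp only [← mul_assoc] at hv
  rw [← hv]
  have hS : (signWeight p u' : ℝ) = signs (u' (Fin.last p)) := by
    rw [signWeight, if_neg (by omega), coord_last]
  rw [hS]
  by_cases hP : (∀ j, z j ≤ y j ∧ u' j ≤ y' j ∧ z j ≤ y' j) ∧ ∀ i : Fin p,
      y i.succ ≤ z i.castSucc ∧ y' i.succ ≤ min (u' i.castSucc) (z i.castSucc)
  · obtain ⟨h1, h2⟩ := hP
    have hzy : Interlaced z y ∧ Interlaced z y' := by
      refine ⟨interlaced_self.2 ⟨fun j => (h1 j).1, fun i => (h2 i).1⟩,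
        interlaced_self.2 ⟨fun j => (h1 j).2.2, fun i => (h2 i).2.trans (min_le_right _ _)⟩⟩
    have hu' : Interlaced u' y' :=
      interlaced_self.2 ⟨fun j => (h1 j).2.1, fun i => (h2 i).2.trans (min_le_left _ _)⟩
    rw [if_pos h1, if_pos hu', rowKernel, if_pos hzy, if_pos rfl, if_neg (by omega), coord_last,
      Finset.prod_congr rfl fun i _ => if_pos (h2 i)]
    -- The powers of `q` match because `max u' z + min u' z = u' + z`.
    have hmm : (∏ i : Fin p, q ^ ((max (u' i.castSucc) (z i.castSucc) : ℕ) : ℤ)) *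
        (∏ i : Fin p, q ^ ((min (u' i.castSucc) (z i.castSucc) : ℕ) : ℤ)) =
        (∏ i : Fin p, q ^ (u' i.castSucc : ℤ)) * ∏ i : Fin p, q ^ (z i.castSucc : ℤ) := by
      rw [← Finset.prod_mul_distrib, ← Finset.prod_mul_distrib]
      apply Finset.prod_congr rfl
      intro i _
      rw [← zpow_add₀ hq', ← zpow_add₀ hq']
      congr 1
      exact_mod_cast max_add_min _ _
    have hpos : ∀ {m : ℕ} (f : Fin m → ℤ), (∏ i, q ^ f i) ≠ 0 := fun f =>
      Finset.prod_ne_zero_iff.2 fun i _ => zpow_ne_zero _ hq'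
    simp only [coord_succ, two_mul (Nat.cast (z _) : ℤ), zpow_sub₀ hq', zpow_add₀ hq',
      Finset.prod_div_distrib, Finset.prod_mul_distrib]
    rw [Fin.prod_univ_castSucc (fun j => q ^ (z j : ℤ)), Fin.prod_univ_succ (fun j => q ^ (y j : ℤ)),
      Fin.prod_univ_castSucc (fun j => q ^ ((max (u' j) (z j) : ℕ) : ℤ)), ← Nat.cast_max]
    have n1 := hpos fun i : Fin p => (z i.castSucc : ℤ)
    have n2 := hpos fun i : Fin p => ((min (u' i.castSucc) (z i.castSucc) : ℕ) : ℤ)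
    have n3 := hpos fun i : Fin p => ((max (u' i.castSucc) (z i.castSucc) : ℕ) : ℤ)
    have n4 : q ^ (z (Fin.last p) : ℤ) ≠ 0 := zpow_ne_zero _ hq'
    have n5 : q ^ ((max (u' (Fin.last p)) (z (Fin.last p)) : ℕ) : ℤ) ≠ 0 := zpow_ne_zero _ hq'
    generalize (∏ i : Fin p, q ^ ((max (u' i.castSucc) (z i.castSucc) : ℕ) : ℤ)) = a at *
    generalize (∏ i : Fin p, q ^ ((min (u' i.castSucc) (z i.castSucc) : ℕ) : ℤ)) = b at *
    generalize (∏ i : Fin p, q ^ (u' i.castSucc : ℤ)) = c at *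
    generalize (∏ i : Fin p, q ^ (z i.castSucc : ℤ)) = d at *
    generalize q ^ (z (Fin.last p) : ℤ) = e at *
    generalize q ^ ((max (u' (Fin.last p)) (z (Fin.last p)) : ℕ) : ℤ) = f at *
    obtain rfl : c = a * b / d := by rw [hmm]; field_simp
    field_simp
    ring
  · trans 0
    · by_contra hne
      apply hP
      simp only [mul_ne_zero_iff, Finset.prod_ne_zero_iff, ite_ne_right_iff] at hne
      obtain ⟨⟨⟨⟨⟨⟨h1, -⟩, h2⟩, -⟩, -⟩, -⟩, -⟩ := hne
      exact ⟨h1, fun i => (h2 i (Finset.mem_univ i)).1⟩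
    · symm
      by_contra hne
      apply hP
      simp only [mul_ne_zero_iff, rowKernel, ite_ne_right_iff, interlaced_self] at hne
      obtain ⟨⟨⟨h1, h2⟩, -⟩, h3, -⟩ := hne
      exact ⟨fun j => ⟨h1.1 j, h3.1 j, h2.1 j⟩, fun i => ⟨h1.2 i, le_min (h3.2 i) (h2.2 i)⟩⟩

end EvenRow

/-- Summing over both positions `u ≥ v` of the last particle of an even row `k - 1`, which is the
neighbour of the reflected particle of row `k`. -/
theorem sum_range_pair_reflected {q : ℝ} (hq : 0 < q) (hq1 : q < 1) (b c u' z : ℕ) :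
    ∑ v ∈ Finset.range (z + 1), (if v ≤ u' then q ^ (-2 * (v : ℤ)) *
        (wallFactor q v * reflProb q (min b v) v c) else 0) *
      (if max b v ≤ z then q ^ ((max b v : ℕ) : ℤ) else 0) =
    if b ≤ z ∧ c ≤ min u' z then (1 - q)⁻¹ * (R q b c * q ^ (-((min u' z : ℕ) : ℤ))) else 0 := by
  have h1q : 1 - q ≠ 0 := by linarith
  by_cases hb : b ≤ z
  · have h1 := sum_range_reflected hq b c (min u' z)
    rw [← sum_range_le_ite] at h1
    simp only [hb, true_and]
    have : (if c ≤ min u' z then (1 - q)⁻¹ * (R q b c * q ^ (-((min u' z : ℕ) : ℤ))) else 0) =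
      (1 - q)⁻¹ * (if c ≤ min u' z then R q b c * q ^ (-((min u' z : ℕ) : ℤ)) else 0) := by
      split_ifs <;> simp
    rw [this, ← h1, inv_mul_cancel_left₀ h1q]
    apply Finset.sum_congr rfl
    intro v hv
    have hv' : max b v ≤ z := by
      have := Finset.mem_range.1 hv
      omega
    rw [if_pos hv']
    by_cases h : v ≤ u'
    · rw [if_pos h, if_pos h, mul_right_comm, ← zpow_add₀ hq.ne']
      congr 2; push_cast; ring
    · simp [h]
  · rw [if_neg (by tauto)]
    apply Finset.sum_eq_zero
    intro v _
    rw [if_neg (by omega : ¬ max b v ≤ z), mul_zero]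

section OddRow

variable {q : ℝ} {p : ℕ} (v u u' z : Fin (p + 1) → ℕ) (y y' : Fin (p + 2) → ℕ)

open Classical in
/-- The analogue of `even_summand_eq` for a row `u` of even index: the next row is longer by one,
and its last particle is reflected. -/
theorem odd_summand_eq (hq : 0 < q) :
    (if Interlaced u y then (signWeight (p + 1) u : ℝ) else 0) * rowKernel q v u u' *
      stepProb q v u u' z y y' =
    (if ∀ i : Fin (p + 1), z i ≤ y i.castSucc ∧ u' i ≤ y' i.castSucc ∧ z i ≤ y' i.castSucc then
      (1 - q) ^ (2 * (p + 1) + 1) * (∏ i, q ^ (u' i : ℤ)) *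
        (∏ j, q ^ (z j : ℤ))⁻¹ * (∏ j, q ^ ((y' j.castSucc : ℤ) - (max (u' j) (z j) : ℕ))) *
        q ^ (y 0 : ℤ)
      else 0) *
    (((∏ i : Fin p, if v i.castSucc ≤ u' i.castSucc ∧ y' i.castSucc.succ ≤ v i.castSucc then
        q ^ (-2 * (v i.castSucc : ℤ)) * (q ^ (min (y i.castSucc.succ) (v i.castSucc) : ℤ) *
          (if y' i.castSucc.succ < v i.castSucc then 1 - q else 1)) else 0) *
      (if v (Fin.last p) ≤ u' (Fin.last p) then q ^ (-2 * (v (Fin.last p) : ℤ)) *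
        (wallFactor q (v (Fin.last p)) * reflProb q (min (y (Fin.last _)) (v (Fin.last p)))
          (v (Fin.last p)) (y' (Fin.last _))) else 0)) *
     (∏ i : Fin (p + 1), if max (y i.succ) (v i) ≤ u i ∧ u i ≤ z i then
        q ^ (u i : ℤ) * (if u i < z i then 1 - q else 1) else 0)) := by
  have hq' := hq.ne'
  have hbar : barrier v y y' (p + 1) = v (Fin.last p) := by
    rw [barrier, if_neg (by omega), coord_last]
  have hb : ∀ i : Fin p, barrier v y y' (i.val + 1) = v i.castSucc :=
    fun i => barrier_succ v y y' i.castSucc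
  have hlast : (Fin.last p).succ = Fin.last (p + 1) := Fin.succ_last p
  by_cases hP : (∀ i : Fin (p + 1), u i ≤ z i ∧ z i ≤ y i.castSucc ∧ u' i ≤ y' i.castSucc ∧
      z i ≤ y' i.castSucc) ∧ ∀ i : Fin (p + 1),
      y i.succ ≤ u i ∧ v i ≤ u i ∧ v i ≤ u' i ∧ y' i.succ ≤ v i
  · obtain ⟨h1, h2⟩ := hP
    have hV : ∀ j : Fin (p + 1), z j ≤ barrier v y y' j ∧ y' j.castSucc ≤ barrier v y y' j := by
      intro j
      induction j using Fin.cases with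
      | zero => have := h1 0; rw [Fin.val_zero, barrier_zero]; simp at this ⊢; omega
      | succ i =>
        have := h1 i.succ
        have := h2 i.castSucc
        rw [Fin.val_succ, hb]
        rw [Fin.succ_castSucc] at this
        omega
    have huy : Interlaced u y := interlaced_succ.2
      fun i => ⟨(h1 i).1.trans (h1 i).2.1, (h2 i).1⟩
    have hvu : Interlaced v u ∧ Interlaced v u' := by
      refine ⟨interlaced_self.2 ⟨fun i => (h2 i).2.1, fun i => ?_⟩,
        interlaced_self.2 ⟨fun i => (h2 i).2.2.1, fun i => ?_⟩⟩ <;>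
      · have := h1 i.succ; have := h2 i.castSucc; rw [Fin.succ_castSucc] at this; omega
    -- On the common support, each factor is a product of powers of `q` and atoms.
    have eL : ∀ j : Fin (p + 1), leftProb q (u j) (min (coord y (j + 1)) (barrier v y y' j)) (z j) *
        rightProb q (max (u' j) (z j)) (barrier v y y' j) (coord y' (j + 1)) =
        q ^ ((min (y j.castSucc) (barrier v y y' j) : ℕ) : ℤ) * (q ^ (z j : ℤ))⁻¹ *
          (if u j < z j then 1 - q else 1) * (q ^ ((y' j.castSucc : ℤ) - (max (u' j) (z j) : ℕ)) *
          (if y' j.castSucc < barrier v y y' j then 1 - q else 1)) := by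
      intro j
      rw [coord_castSucc, coord_castSucc, leftProb, rightProb,
        if_pos ⟨(h1 j).1, le_min (h1 j).2.1 (hV j).1⟩,
        if_pos (show max (u' j) (z j) ≤ y' j.castSucc ∧ _ from
          ⟨max_le (h1 j).2.2.1 (h1 j).2.2.2, (hV j).2⟩), zpow_sub₀ hq', div_eq_mul_inv]
    have eMin : ∏ j : Fin (p + 1), q ^ ((min (y j.castSucc) (barrier v y y' j) : ℕ) : ℤ) =
        q ^ (y 0 : ℤ) * ∏ i : Fin p, q ^ (min (y i.castSucc.succ) (v i.castSucc) : ℤ) := by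
      rw [Fin.prod_univ_succ]
      simp only [Fin.val_zero, barrier_zero, Fin.val_succ, hb, Fin.castSucc_zero, Fin.succ_castSucc]
      rw [min_eq_left (by omega)]
      push_cast
      rfl
    have eAtom : ∏ j : Fin (p + 1), (if y' j.castSucc < barrier v y y' j then 1 - q else 1) =
        (1 - q) * ∏ i : Fin p, (if y' i.castSucc.succ < v i.castSucc then 1 - q else 1) := by
      rw [Fin.prod_univ_succ]
      simp only [Fin.val_zero, barrier_zero, Fin.val_succ, hb, Fin.castSucc_zero, Fin.succ_castSucc]
      rw [if_pos (by omega)]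
    have eSgn : signWeight (p + 1) u = 1 := by rw [signWeight, if_pos rfl]
    have eK : rowKernel q v u u' = (1 - q) ^ (2 * (p + 1)) *
        ((∏ i, q ^ (u i : ℤ)) * (∏ i, q ^ (u' i : ℤ)) *
          ∏ i, q ^ (-2 * (v i : ℤ))) * wallFactor q (v (Fin.last p)) := by
      rw [rowKernel, if_pos hvu, if_pos rfl, if_neg (by omega), coord_last,
        ← Finset.prod_mul_distrib, ← Finset.prod_mul_distrib]
      congr 2
      apply Finset.prod_congr rfl
      intro i _
      rw [coord_succ, coord_succ, ← zpow_add₀ hq', ← zpow_add₀ hq']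
      ring_nf
    have eA : ∀ i : Fin p, (if v i.castSucc ≤ u' i.castSucc ∧ y' i.castSucc.succ ≤ v i.castSucc then
        q ^ (-2 * (v i.castSucc : ℤ)) * (q ^ (min (y i.castSucc.succ) (v i.castSucc) : ℤ) *
          (if y' i.castSucc.succ < v i.castSucc then 1 - q else 1)) else 0) =
        q ^ (-2 * (v i.castSucc : ℤ)) * (q ^ (min (y i.castSucc.succ) (v i.castSucc) : ℤ) *
          (if y' i.castSucc.succ < v i.castSucc then 1 - q else 1)) :=
      fun i => if_pos ⟨(h2 _).2.2.1, (h2 _).2.2.2⟩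
    have eB : ∀ i : Fin (p + 1), (if max (y i.succ) (v i) ≤ u i ∧ u i ≤ z i then
        q ^ (u i : ℤ) * (if u i < z i then 1 - q else 1) else 0) =
        q ^ (u i : ℤ) * (if u i < z i then 1 - q else 1) :=
      fun i => if_pos ⟨max_le (h2 i).1 (h2 i).2.1, (h1 _).1⟩
    rw [if_pos huy, stepProb, if_neg (by omega), eK, eSgn, if_pos fun j => (h1 j).2,
      if_pos (h2 _).2.2.1, show p + 1 + 1 - 1 = p + 1 by omega, hbar, coord_last, coord_last]
    simp only [eL, eA, eB, Finset.prod_mul_distrib, Finset.prod_inv_distrib]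
    rw [eMin, eAtom, Fin.prod_univ_castSucc (fun j => q ^ (-2 * (v j : ℤ)))]
    push_cast
    ring
  -- Off this set of `u` and `v`, both sides vanish.
  · trans 0
    · by_contra hne
      apply hP
      simp only [mul_ne_zero_iff, stepProb, rowKernel, leftProb, rightProb, Finset.prod_ne_zero_iff,
        ite_ne_right_iff, interlaced_self, interlaced_succ, coord_castSucc] at hne
      obtain ⟨⟨⟨h1, -⟩, ⟨⟨h3, h4⟩, -⟩⟩, ⟨h5, h8⟩⟩ := hne
      have h6 : ∀ j : Fin (p + 1), (u j ≤ z j ∧ z j ≤ min (y j.castSucc) (barrier v y y' j)) ∧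
          max (u' j) (z j) ≤ y' j.castSucc ∧ y' j.castSucc ≤ barrier v y y' j := fun j =>
        ⟨(h5 j (Finset.mem_univ j)).1.1, (h5 j (Finset.mem_univ j)).2.1⟩
      refine ⟨fun j => ?_, fun i => ⟨(h1 i).2, h3.1 i, h4.1 i, ?_⟩⟩
      · have := h6 j
        omega
      · induction i using Fin.lastCases with
        | last =>
          rw [if_neg (by omega), show p + 1 + 1 - 1 = p + 1 by omega, hbar, coord_last,
            coord_last, reflProb] at h8
          by_contra hlt
          rw [hlast] at hlt
          rw [if_neg (by omega), if_neg (by omega)] at h8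
          exact h8 rfl
        | cast i =>
          have h7 := (h6 i.succ).2.2
          rw [Fin.val_succ, hb] at h7
          exact h7
    · symm
      by_contra hne
      apply hP
      simp only [mul_ne_zero_iff, Finset.prod_ne_zero_iff, ite_ne_right_iff, reflProb] at hne
      obtain ⟨⟨h1, -⟩, ⟨h2, ⟨h4, -, -, h5⟩⟩, h3⟩ := hne
      have h3' := fun i => (h3 i (Finset.mem_univ i)).1
      refine ⟨fun j => ⟨(h3' j).2, h1 j⟩, fun i => ?_⟩
      have := h3' i
      induction i using Fin.lastCases with
      | last =>
        rw [hlast] at this ⊢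
        refine ⟨by omega, by omega, h4, ?_⟩
        by_contra hlt
        rw [if_neg (by omega), if_neg (by omega)] at h5
        exact h5 rfl
      | cast i =>
        have := (h2 i (Finset.mem_univ i)).1
        omega

open Classical in
/-- The one-step intertwining when the next row has an odd index, hence a reflected particle. -/
theorem odd_sum_eq (hq : 0 < q) (hq1 : q < 1) :
    ∑ u ∈ Fintype.piFinset (fun i => Finset.range (z i + 1)),
      ∑ v ∈ Fintype.piFinset (fun i => Finset.range (z i + 1)),
        (if Interlaced u y then (signWeight (p + 1) u : ℝ) else 0) * rowKernel q v u u' *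
          stepProb q v u u' z y y' =
    rowKernel q z y y' * (if Interlaced u' y' then (signWeight (p + 1) u' : ℝ) else 0) := by
  have hq' := hq.ne'
  have h1q : 1 - q ≠ 0 := by linarith
  rw [Finset.sum_comm]
  simp only [odd_summand_eq _ _ _ _ _ _ hq, ← Finset.mul_sum]
  -- The sum over `u`, coordinate by coordinate.
  have hu : ∀ v : Fin (p + 1) → ℕ, ∑ u ∈ Fintype.piFinset (fun i => Finset.range (z i + 1)),
      (∏ i : Fin (p + 1), if max (y i.succ) (v i) ≤ u i ∧ u i ≤ z i then
        q ^ (u i : ℤ) * (if u i < z i then 1 - q else 1) else 0) =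
      (∏ i : Fin p, if max (y i.castSucc.succ) (v i.castSucc) ≤ z i.castSucc then
        q ^ ((max (y i.castSucc.succ) (v i.castSucc) : ℕ) : ℤ) else 0) *
      (if max (y (Fin.last _)) (v (Fin.last p)) ≤ z (Fin.last p) then
        q ^ ((max (y (Fin.last _)) (v (Fin.last p)) : ℕ) : ℤ) else 0) := by
    intro v
    have h := Finset.prod_univ_sum (fun j => Finset.range (z j + 1))
      (fun (i : Fin (p + 1)) (x : ℕ) => if max (y i.succ) (v i) ≤ x ∧ x ≤ z i then
          q ^ (x : ℤ) * (if x < z i then 1 - q else 1) else 0)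
    simp only [sum_range_atom] at h
    rw [← h, Fin.prod_univ_castSucc, Fin.succ_last]
  simp only [hu]
  -- The sum over `v`, coordinate by coordinate.
  have hv := Finset.prod_univ_sum (fun i : Fin (p + 1) => Finset.range (z i + 1))
    (fun (i : Fin (p + 1)) (x : ℕ) => (Fin.lastCases (motive := fun _ => ℕ → ℝ)
      (fun x => (if x ≤ u' (Fin.last p) then q ^ (-2 * (x : ℤ)) *
        (wallFactor q x * reflProb q (min (y (Fin.last _)) x) x (y' (Fin.last _))) else 0) *
      (if max (y (Fin.last _)) x ≤ z (Fin.last p) then q ^ ((max (y (Fin.last _)) x : ℕ) : ℤ)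
        else 0))
      (fun i x => (if x ≤ u' i.castSucc ∧ y' i.castSucc.succ ≤ x then q ^ (-2 * (x : ℤ)) *
        (q ^ (min (y i.castSucc.succ) x : ℤ) * (if y' i.castSucc.succ < x then 1 - q else 1))
          else 0) *
      (if max (y i.castSucc.succ) x ≤ z i.castSucc then q ^ ((max (y i.castSucc.succ) x : ℕ) : ℤ)
        else 0)) i) x)
  simp only [Fin.prod_univ_castSucc, Fin.lastCases_castSucc, Fin.lastCases_last,
    sum_range_pair hq, sum_range_pair_reflected hq hq1] at hv
  have hcomm : ∀ a b c d : ℝ, a * b * (c * d) = a * c * (b * d) := fun a b c d => by ring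
  rw [Finset.sum_congr rfl fun v _ => hcomm _ _ _ _]
  simp only [← Finset.prod_mul_distrib, ← hv]
  have hS : ∀ x : Fin (p + 1) → ℕ, (signWeight (p + 1) x : ℝ) = 1 := fun x => by
    rw [signWeight, if_pos rfl, Nat.cast_one]
  rw [hS]
  by_cases hP : (∀ i : Fin (p + 1), z i ≤ y i.castSucc ∧ u' i ≤ y' i.castSucc ∧
      z i ≤ y' i.castSucc) ∧ ∀ i : Fin (p + 1), y i.succ ≤ z i ∧ y' i.succ ≤ min (u' i) (z i)
  · obtain ⟨h1, h2⟩ := hP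
    have hzy : Interlaced z y ∧ Interlaced z y' :=
      ⟨interlaced_succ.2 fun i => ⟨(h1 i).1, (h2 i).1⟩,
        interlaced_succ.2 fun i => ⟨(h1 i).2.2, (h2 i).2.trans (min_le_right _ _)⟩⟩
    have hu' : Interlaced u' y' :=
      interlaced_succ.2 fun i => ⟨(h1 i).2.1, (h2 i).2.trans (min_le_left _ _)⟩
    have hl : y (Fin.last (p + 1)) ≤ z (Fin.last p) ∧
        y' (Fin.last (p + 1)) ≤ min (u' (Fin.last p)) (z (Fin.last p)) := h2 (Fin.last p)
    rw [if_pos h1, Finset.prod_congr rfl fun i _ => if_pos (h2 (Fin.castSucc i)), if_pos hl,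
      if_pos hu', rowKernel, if_pos hzy, if_neg (by omega : ¬ p + 2 = p + 1), coord_last,
      coord_last]
    -- The powers of `q` match because `max u' z + min u' z = u' + z`.
    have hmm : (∏ i : Fin (p + 1), q ^ ((max (u' i) (z i) : ℕ) : ℤ)) *
        (∏ i : Fin (p + 1), q ^ ((min (u' i) (z i) : ℕ) : ℤ)) =
        (∏ i : Fin (p + 1), q ^ (u' i : ℤ)) * ∏ i : Fin (p + 1), q ^ (z i : ℤ) := by
      rw [← Finset.prod_mul_distrib, ← Finset.prod_mul_distrib]
      apply Finset.prod_congr rfl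
      intro i _
      rw [← zpow_add₀ hq', ← zpow_add₀ hq']
      congr 1
      exact_mod_cast max_add_min _ _
    have hpos : ∀ {m : ℕ} (f : Fin m → ℤ), (∏ i, q ^ f i) ≠ 0 := fun f =>
      Finset.prod_ne_zero_iff.2 fun i _ => zpow_ne_zero _ hq'
    simp only [coord_castSucc, two_mul (Nat.cast (z _) : ℤ), zpow_sub₀ hq', zpow_add₀ hq',
      Finset.prod_div_distrib, Finset.prod_mul_distrib, zpow_neg]
    rw [Fin.prod_univ_succ (fun j => q ^ (y (Fin.castSucc j) : ℤ))]
    rw [Fin.prod_univ_castSucc (fun j => q ^ ((min (u' j) (z j) : ℕ) : ℤ))] at hmm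
    simp only [Fin.succ_castSucc, Fin.castSucc_zero]
    have n1 := hpos fun i : Fin (p + 1) => (z i : ℤ)
    have n2 := hpos fun i : Fin p => ((min (u' i.castSucc) (z i.castSucc) : ℕ) : ℤ)
    have n3 := hpos fun i : Fin (p + 1) => ((max (u' i) (z i) : ℕ) : ℤ)
    have n4 : q ^ ((min (u' (Fin.last p)) (z (Fin.last p)) : ℕ) : ℤ) ≠ 0 := zpow_ne_zero _ hq'
    generalize (∏ i : Fin (p + 1), q ^ ((max (u' i) (z i) : ℕ) : ℤ)) = a at *
    generalize (∏ i : Fin p, q ^ ((min (u' i.castSucc) (z i.castSucc) : ℕ) : ℤ)) = b at *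
    generalize (∏ i : Fin (p + 1), q ^ (u' i : ℤ)) = c at *
    generalize (∏ i : Fin (p + 1), q ^ (z i : ℤ)) = d at *
    generalize q ^ ((min (u' (Fin.last p)) (z (Fin.last p)) : ℕ) : ℤ) = e at *
    obtain rfl : c = a * (b * e) / d := by rw [hmm]; field_simp
    field_simp
    ring
  · trans 0
    · by_contra hne
      apply hP
      simp only [mul_ne_zero_iff, Finset.prod_ne_zero_iff, ite_ne_right_iff] at hne
      obtain ⟨⟨h1, -⟩, h2, ⟨h3, -⟩⟩ := hne
      refine ⟨h1, fun i => ?_⟩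
      induction i using Fin.lastCases with
      | last => exact h3
      | cast i => exact (h2 i (Finset.mem_univ i)).1
    · symm
      by_contra hne
      apply hP
      simp only [mul_ne_zero_iff, rowKernel, ite_ne_right_iff, interlaced_succ] at hne
      obtain ⟨⟨⟨h1, h2⟩, -⟩, h3, -⟩ := hne
      exact ⟨fun j => ⟨(h1 j).1, (h3 j).1, (h2 j).1⟩,
        fun i => ⟨(h1 i).2, le_min (h3 i).2 (h2 i).2⟩⟩

end OddRow

/-! ### Counting Gelfand-Tsetlin patterns -/

/-- The sign condition on row `k` of a pattern: all entries are nonnegative, except possibly the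
last entry of an odd row. -/
def SignOK (k : ℕ) (x : Fin ((k + 1) / 2) → ℤ) : Prop :=
  ∀ j : Fin ((k + 1) / 2), ¬ (Odd k ∧ j.val + 1 = (k + 1) / 2) → 0 ≤ x j

/-- The patterns with `k` rows and last row `y`. -/
def patterns (k : ℕ) (y : Fin ((k + 1) / 2) → ℤ) :
    Set ((i : Fin (k + 1)) → Fin ((i.val + 1) / 2) → ℤ) :=
  {x | x ∈ GT k ∧ x (Fin.last k) = y}

theorem mem_GT_succ {k : ℕ} (x : (i : Fin (k + 2)) → Fin ((i.val + 1) / 2) → ℤ) :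
    x ∈ GT (k + 1) ↔ (fun i : Fin (k + 1) => x i.castSucc) ∈ GT k ∧
      SignOK (k + 1) (x (Fin.last (k + 1))) ∧
      Interlaced (fun j => |x (Fin.last k).castSucc j|) (fun j => |x (Fin.last (k + 1)) j|) := by
  constructor
  · rintro ⟨h1, h2⟩
    exact ⟨⟨fun i => h1 i.castSucc, fun i => h2 i.castSucc⟩, h1 (Fin.last _), h2 (Fin.last _)⟩
  · rintro ⟨⟨h1, h2⟩, h3, h4⟩
    refine ⟨fun i => ?_, fun i => ?_⟩
    · induction i using Fin.lastCases with
      | last => exact h3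
      | cast i => exact h1 i
    · induction i using Fin.lastCases with
      | last => exact h4
      | cast i => exact h2 i

theorem signOK_of_mem_patterns {k : ℕ} {y : Fin ((k + 1) / 2) → ℤ}
    {x : (i : Fin (k + 1)) → Fin ((i.val + 1) / 2) → ℤ} (h : x ∈ patterns k y) : SignOK k y := by
  rw [← h.2]
  exact h.1.1 (Fin.last k)

theorem sigma_patterns_ext {k : ℕ} {L : Finset (Fin ((k + 1) / 2) → ℤ)}
    {a b : Σ l : L, patterns k l.1} (h : a.2.1 = b.2.1) : a = b := by
  obtain ⟨⟨l, hl⟩, ⟨x, hx⟩⟩ := a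
  obtain ⟨⟨l', hl'⟩, ⟨x', hx'⟩⟩ := b
  obtain rfl : x = x' := h
  obtain rfl : l = l' := hx.2.symm.trans hx'.2
  rfl

/-- Removing the last row of a pattern; `L` is any finite set whose elements with the signs of row
`k` are the possible last but one rows. -/
def patternsEquiv (k : ℕ) (y : Fin ((k + 2) / 2) → ℤ) (hy : SignOK (k + 1) y)
    (L : Finset (Fin ((k + 1) / 2) → ℤ))
    (hL : ∀ l, SignOK k l → (l ∈ L ↔ Interlaced (fun j => |l j|) (fun j => |y j|))) :
    patterns (k + 1) y ≃ Σ l : L, patterns k l.1 where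
  toFun x := ⟨⟨x.1 (Fin.last k).castSucc, by
      have h := (mem_GT_succ x.1).1 x.2.1
      have h2 := h.2.2
      rw [x.2.2] at h2
      exact (hL _ (h.1.1 (Fin.last k))).2 h2⟩,
    ⟨fun i => x.1 i.castSucc, ((mem_GT_succ x.1).1 x.2.1).1, rfl⟩⟩
  invFun w := ⟨Fin.snoc (α := fun i : Fin (k + 2) => Fin ((i.val + 1) / 2) → ℤ) w.2.1 y, by
    refine ⟨(mem_GT_succ _).2 ?_, Fin.snoc_last _ _⟩
    simp only [Fin.snoc_castSucc, Fin.snoc_last]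
    refine ⟨w.2.2.1, hy, ?_⟩
    have h := (hL _ (signOK_of_mem_patterns w.2.2)).1 w.1.2
    rw [w.2.2.2]
    exact h⟩
  left_inv x := by
    apply Subtype.ext
    funext i
    induction i using Fin.lastCases with
    | last => simp only [Fin.snoc_last]; exact x.2.2.symm
    | cast i => simp only [Fin.snoc_castSucc]
  right_inv w := by
    apply sigma_patterns_ext
    funext i
    simp only [Fin.snoc_castSucc]

/-- Entrywise absolute values. -/
def absRow {d : ℕ} (l : Fin d → ℤ) : Fin d → ℕ := fun j => (l j).natAbs

/-- The rows that satisfy the sign condition of row `k`, with entrywise absolute value `u`. -/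
def lifts (k : ℕ) (u : Fin ((k + 1) / 2) → ℕ) : Finset (Fin ((k + 1) / 2) → ℤ) :=
  Fintype.piFinset fun j =>
    if Odd k ∧ j.val + 1 = (k + 1) / 2 then {(u j : ℤ), -(u j : ℤ)} else {(u j : ℤ)}

theorem mem_lifts {k : ℕ} {u : Fin ((k + 1) / 2) → ℕ} {l : Fin ((k + 1) / 2) → ℤ} :
    l ∈ lifts k u ↔ SignOK k l ∧ absRow l = u := by
  simp only [lifts, Fintype.mem_piFinset, SignOK, absRow, funext_iff, ← forall_and]
  apply forall_congr'
  intro j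
  split_ifs with h
  · rw [Finset.mem_insert, Finset.mem_singleton]
    constructor
    · exact fun hl => ⟨fun h' => absurd h h', by omega⟩
    · rintro ⟨-, hl⟩
      omega
  · rw [Finset.mem_singleton]
    constructor
    · exact fun hl => ⟨fun _ => by omega, by omega⟩
    · rintro ⟨h1, h2⟩
      have := h1 h
      omega

theorem card_lifts (k : ℕ) (u : Fin ((k + 1) / 2) → ℕ) :
    (lifts k u).card = signWeight (k / 2) u := by
  rw [lifts, Fintype.card_piFinset, signWeight]
  rcases Nat.even_or_odd k with hk | hk
  · have h2 : ¬ Odd k := Nat.not_odd_iff_even.2 hk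
    rw [if_pos (by obtain ⟨r, rfl⟩ := hk; omega)]
    simp [h2]
  · obtain ⟨r, rfl⟩ := hk
    rw [if_neg (by omega)]
    have hd : (2 * r + 1 + 1) / 2 = r + 1 := by omega
    have ho : Odd (2 * r + 1) := ⟨r, rfl⟩
    rw [Finset.prod_eq_single (⟨r, by omega⟩ : Fin ((2 * r + 1 + 1) / 2))]
    · rw [if_pos ⟨ho, hd.symm⟩]
      have hc : coord u ((2 * r + 1 + 1) / 2) = u ⟨r, by omega⟩ := by
        rw [coord, dif_pos (by omega)]
        congr 2
        omega
      rw [hc, signs]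
      split_ifs with h
      · simp [h]
      · rw [Finset.card_pair]
        omega
    · intro j _ hj
      rw [if_neg, Finset.card_singleton]
      rintro ⟨-, h⟩
      exact hj (Fin.ext (by simp only; omega))
    · intro h
      exact absurd (Finset.mem_univ _) h

open Classical in
/-- The vectors of length `d` interlacing with `y` from below. -/
def below (d : ℕ) {n : ℕ} (y : Fin n → ℕ) : Finset (Fin d → ℕ) :=
  (Fintype.piFinset fun i : Fin d => Finset.range (coord y (i + 1) + 1)).filter
    fun u => Interlaced u y

theorem mem_below {d n : ℕ} (hd : d ≤ n) {y : Fin n → ℕ} {u : Fin d → ℕ} :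
    u ∈ below d y ↔ Interlaced u y := by
  simp only [below, Finset.mem_filter, Fintype.mem_piFinset, Finset.mem_range,
    and_iff_right_iff_imp]
  intro h i
  have := h.1 i ⟨i, by omega⟩ rfl
  have e : coord y (i + 1) = y ⟨i, by omega⟩ := coord_succ y ⟨i, by omega⟩
  omega

theorem interlaced_abs {m n : ℕ} (x : Fin m → ℤ) (y : Fin n → ℤ) :
    Interlaced (fun j => |x j|) (fun j => |y j|) ↔ Interlaced (absRow x) (absRow y) := by
  simp only [Interlaced, absRow, Int.abs_eq_natAbs, Nat.cast_le]

open Classical in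
theorem mem_biUnion_lifts {k : ℕ} {y : Fin ((k + 2) / 2) → ℤ} (l : Fin ((k + 1) / 2) → ℤ)
    (hl : SignOK k l) : l ∈ (below ((k + 1) / 2) (absRow y)).biUnion (lifts k) ↔
      Interlaced (fun j => |l j|) (fun j => |y j|) := by
  rw [interlaced_abs, Finset.mem_biUnion]
  constructor
  · rintro ⟨u, hu, hlu⟩
    rw [(mem_lifts.1 hlu).2]
    exact (mem_below (by omega)).1 hu
  · intro h
    exact ⟨absRow l, (mem_below (by omega)).2 h, mem_lifts.2 ⟨hl, rfl⟩⟩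

theorem patterns_finite (k : ℕ) (y : Fin ((k + 1) / 2) → ℤ) : Finite (patterns k y) := by
  classical
  induction k with
  | zero =>
    have : Subsingleton (patterns 0 y) := ⟨fun a b => Subtype.ext (by
      funext i j
      have hi : i = 0 := Fin.ext (by omega)
      subst hi
      exact Fin.elim0 j)⟩
    exact Finite.of_subsingleton
  | succ k ih =>
    by_cases hy : SignOK (k + 1) y
    · exact Finite.of_equiv _ (patternsEquiv k y hy _ mem_biUnion_lifts).symm
    · exact @Finite.of_subsingleton _
        ⟨fun a b => absurd (signOK_of_mem_patterns a.2) hy⟩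

/-- The patterns with last row `y` are sorted by their last but one row `l` and its absolute
value `u`. -/
theorem s_succ (k : ℕ) (y : Fin ((k + 2) / 2) → ℤ) (hy : SignOK (k + 1) y) :
    s (k + 1) y = ∑ u ∈ below ((k + 1) / 2) (absRow y), ∑ l ∈ lifts k u, s k l := by
  classical
  have := patterns_finite k
  have h : ∀ k y, s k y = Nat.card (patterns k y) := fun _ _ => rfl
  rw [h, Nat.card_congr (patternsEquiv k y hy _ mem_biUnion_lifts), Nat.card_sigma,
    Finset.sum_coe_sort (f := fun l => Nat.card (patterns k l)), Finset.sum_biUnion]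
  · rfl
  · intro u _ u' _ hne
    refine Finset.disjoint_left.2 fun l hl hl' => hne ?_
    rw [← (mem_lifts.1 hl).2, (mem_lifts.1 hl').2]

theorem absRow_cast {d : ℕ} (u : Fin d → ℕ) : absRow (fun j => (u j : ℤ)) = u := by
  funext j
  simp [absRow]

theorem signOK_cast (k : ℕ) (u : Fin ((k + 1) / 2) → ℕ) : SignOK k (fun j => (u j : ℤ)) :=
  fun j _ => Int.natCast_nonneg (u j)

/-- The number of patterns depends on the last row through its absolute values only. -/
theorem s_abs (k : ℕ) (y : Fin ((k + 1) / 2) → ℤ) (hy : SignOK k y) :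
    s k y = s k (fun j => (absRow y j : ℤ)) := by
  cases k with
  | zero =>
    congr 1
    funext j
    exact Fin.elim0 j
  | succ k => rw [s_succ k y hy, s_succ k _ (signOK_cast _ _), absRow_cast]

/-- The number of patterns whose last row is a vector of natural numbers. -/
def count (k : ℕ) (u : Fin ((k + 1) / 2) → ℕ) : ℕ := s k (fun j => (u j : ℤ))

/-- The branching rule for the number of patterns, with signs forgotten. -/
theorem count_succ (k : ℕ) (y : Fin ((k + 2) / 2) → ℕ) :
    count (k + 1) y = ∑ u ∈ below ((k + 1) / 2) y, signWeight (k / 2) u * count k u := by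
  rw [count, s_succ k _ (signOK_cast _ _), absRow_cast]
  apply Finset.sum_congr rfl
  intro u _
  rw [← card_lifts, ← smul_eq_mul, ← Finset.sum_const]
  apply Finset.sum_congr rfl
  intro l hl
  obtain ⟨h1, h2⟩ := mem_lifts.1 hl
  rw [s_abs k l h1, h2, count]

theorem signWeight_pos (p : ℕ) {d : ℕ} (u : Fin d → ℕ) : 0 < signWeight p u := by
  rw [signWeight, signs]
  split_ifs <;> norm_num

theorem count_pos (k : ℕ) (y : Fin ((k + 1) / 2) → ℕ) (hy : Antitone y) : 0 < count k y := by
  induction k with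
  | zero =>
    have h : count 0 y = Nat.card (patterns 0 fun j => (y j : ℤ)) := rfl
    rw [h]
    have := patterns_finite 0 fun j => (y j : ℤ)
    have : Nonempty (patterns 0 fun j => (y j : ℤ)) := by
      refine ⟨⟨fun _ _ => 0, ⟨fun _ _ _ => le_rfl, fun i => Fin.elim0 i⟩, ?_⟩⟩
      funext j
      exact Fin.elim0 j
    exact Nat.card_pos
  | succ k ih =>
    rw [count_succ]
    have hle : (k + 1) / 2 ≤ (k + 2) / 2 := by omega
    refine lt_of_lt_of_le (Nat.mul_pos (signWeight_pos (k / 2) fun i => y (Fin.castLE hle i))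
      (ih (fun i => y (Fin.castLE hle i)) fun i j hij => hy hij))
      (Finset.single_le_sum (f := fun u => signWeight (k / 2) u * count k u)
        (fun _ _ => Nat.zero_le _) ((mem_below hle).2 ⟨fun i j hij => ?_, fun i j hij => ?_⟩))
    · exact hy (Fin.le_def.2 (by simp [hij]))
    · exact hy (Fin.le_def.2 (by simp [hij]))

/-! ### The intertwining of the kernels -/

open Classical in
/-- The one-step intertwining of two consecutive rows, before normalization by the numbers of
patterns. -/
theorem row_sum_eq {q : ℝ} (hq : 0 < q) (hq1 : q < 1) {p d n : ℕ} (hd : d = p ∨ d = p + 1)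
    (hn : n = p + 1) (u' z : Fin d → ℕ) (y y' : Fin n → ℕ) :
    ∑ u ∈ Fintype.piFinset (fun i => Finset.range (z i + 1)),
      ∑ v ∈ Fintype.piFinset (fun i : Fin p => Finset.range (coord z (i + 1) + 1)),
        (if Interlaced u y then (signWeight p u : ℝ) else 0) * rowKernel q v u u' *
          stepProb q v u u' z y y' =
    rowKernel q z y y' * (if Interlaced u' y' then (signWeight p u' : ℝ) else 0) := by
  subst hn
  rcases hd with rfl | rfl
  · cases d with
    -- A single reflected particle, driven by the empty row `0`.
    | zero =>
      have hI : ∀ {m n : ℕ} (x : Fin m → ℕ) (w : Fin n → ℕ), m = 0 → n ≤ 1 → Interlaced x w :=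
        fun x w h _ => ⟨fun i => absurd i.2 (by omega), fun i => absurd i.2 (by omega)⟩
      have hlt : coord y' 1 < coord y 1 + coord y' 1 + 1 := by omega
      have hmin : min (coord y 1) (coord y 1 + coord y' 1 + 1) = coord y 1 := by omega
      simp [hI, signWeight, rowKernel, stepProb, barrier, reflProb, hlt, hmin]
    | succ p =>
      simp only [coord_succ]
      exact odd_sum_eq u' z y y' hq hq1
  · simp only [coord_castSucc]
    exact even_sum_eq u' z y y' hq

theorem leftProb_nonneg {q : ℝ} (hq : 0 < q) (hq1 : q < 1) (u x z : ℕ) : 0 ≤ leftProb q u x z := by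
  have : 0 ≤ 1 - q := by linarith
  rw [leftProb]
  split_ifs <;> positivity

theorem rightProb_nonneg {q : ℝ} (hq : 0 < q) (hq1 : q < 1) (m c y : ℕ) :
    0 ≤ rightProb q m c y := by
  have : 0 ≤ 1 - q := by linarith
  rw [rightProb]
  split_ifs <;> positivity

theorem R_nonneg {q : ℝ} (hq : 0 < q) (hq1 : q < 1) (x y : ℕ) : 0 ≤ R q x y := by
  have : 0 ≤ 1 - q := by linarith
  rw [R]
  split_ifs <;> positivity

theorem reflProb_nonneg {q : ℝ} (hq : 0 < q) (hq1 : q < 1) (x c y : ℕ) : 0 ≤ reflProb q x c y := by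
  have := R_nonneg hq hq1 x y
  rw [reflProb]
  split_ifs <;> positivity

theorem stepProb_nonneg {q : ℝ} (hq : 0 < q) (hq1 : q < 1) {p d n : ℕ} (v : Fin p → ℕ)
    (u u' z : Fin d → ℕ) (y y' : Fin n → ℕ) : 0 ≤ stepProb q v u u' z y y' := by
  rw [stepProb]
  refine mul_nonneg (Finset.prod_nonneg fun i _ =>
    mul_nonneg (leftProb_nonneg hq hq1 _ _ _) (rightProb_nonneg hq hq1 _ _ _)) ?_
  split_ifs
  · exact zero_le_one
  · exact reflProb_nonneg hq hq1 _ _ _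

theorem rowKernel_nonneg {q : ℝ} (hq : 0 < q) (hq1 : q < 1) {m n : ℕ} (z : Fin m → ℕ)
    (y y' : Fin n → ℕ) : 0 ≤ rowKernel q z y y' := by
  have : 0 ≤ 1 - q := by linarith
  have := R_nonneg hq hq1 (coord y n) (coord y' n)
  rw [rowKernel, wallFactor]
  split_ifs <;> positivity

theorem interlaced_of_rowKernel_ne_zero {q : ℝ} {m n : ℕ} {z : Fin m → ℕ} {y y' : Fin n → ℕ}
    (h : rowKernel q z y y' ≠ 0) : Interlaced z y ∧ Interlaced z y' := by
  by_contra hc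
  exact h (by rw [rowKernel, if_neg hc])

/-- The kernel `S_k`, as a function of the current vector `y` and the next state `p'`. It is also
defined for `k = 0`, where the state space is a single point. -/
def kern (q : ℝ) (k : ℕ) (y : Fin ((k + 1) / 2) → ℕ) (p' : PairState k) : ℝ :=
  (count k p'.2 : ℝ) / count k y * rowKernel q p'.1 y p'.2

open Classical in
/-- The law of row `k` of a uniform pattern with `k + 1` rows, last row `y`, and signs forgotten. -/
def link (k : ℕ) (y : Fin ((k + 2) / 2) → ℕ) (u : Fin ((k + 1) / 2) → ℕ) : ℝ :=
  if Interlaced u y then (signWeight (k / 2) u : ℝ) * count k u / count (k + 1) y else 0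

theorem kern_nonneg {q : ℝ} (hq : 0 < q) (hq1 : q < 1) (k : ℕ) (y : Fin ((k + 1) / 2) → ℕ)
    (p' : PairState k) : 0 ≤ kern q k y p' :=
  mul_nonneg (by positivity) (rowKernel_nonneg hq hq1 _ _ _)

theorem link_nonneg (k : ℕ) (y : Fin ((k + 2) / 2) → ℕ) (u : Fin ((k + 1) / 2) → ℕ) :
    0 ≤ link k y u := by
  rw [link]
  split_ifs <;> positivity

theorem prod_zpow_eq {q : ℝ} (hq : q ≠ 0) (n : ℕ) (f : ℕ → ℤ) :
    ∏ i : Fin n, q ^ f (i + 1) = q ^ ∑ i ∈ Finset.Icc 1 n, f i := by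
  rw [Fin.prod_univ_eq_prod_range (fun i => q ^ f (i + 1)) n]
  induction n with
  | zero => simp
  | succ n ih => rw [Finset.prod_range_succ, ih, Finset.sum_Icc_succ_top (by omega), zpow_add₀ hq]

/-- `S_k` does not depend on the component `z` of the current state. -/
theorem S_eq_kern {q : ℝ} (hq : 0 < q) {k : ℕ} (hk : 1 ≤ k) (p p' : PairState k) :
    S q k p p' = kern q k p.2 p' := by
  rw [S, kern, rowKernel]
  have hc : ∀ y, s k (fun j => (y j : ℤ)) = count k y := fun _ => rfl
  simp only [hc]
  by_cases hI : Interlaced p'.1 p.2 ∧ Interlaced p'.1 p'.2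
  · rw [if_pos hI, if_pos hI]
    have hz : ∀ i : Fin (k / 2), (p'.1 i : ℤ) = coord p'.1 (i + 1) := fun i => by rw [coord_succ]
    simp only [hz]
    rw [prod_zpow_eq hq.ne' (k / 2) fun i => (coord p.2 i : ℤ) + coord p'.2 i - 2 * coord p'.1 i]
    rcases Nat.even_or_odd k with he | ho
    · have h1 : (k + 1) / 2 = k / 2 := by obtain ⟨r, rfl⟩ := he; omega
      have h2 : k / 2 ≠ 0 := by obtain ⟨r, rfl⟩ := he; omega
      have h3 : 2 * (k / 2) = k := Nat.two_mul_div_two_of_even he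
      rw [if_pos he, if_pos h1, if_neg h2, h3, wallFactor]
      ring
    · have h1 : (k + 1) / 2 - 1 = k / 2 := by obtain ⟨r, rfl⟩ := ho; omega
      have h2 : (k + 1) / 2 ≠ k / 2 := by obtain ⟨r, rfl⟩ := ho; omega
      have h3 : 2 * (k / 2) = k - 1 := by obtain ⟨r, rfl⟩ := ho; omega
      rw [if_neg (Nat.not_even_iff_odd.2 ho), h1, if_neg h2, h3]
      ring
  · rw [if_neg hI, if_neg hI, mul_zero]

theorem antitone_of_interlaced {m n : ℕ} {z : Fin m → ℕ} {y : Fin n → ℕ} (h : Interlaced z y)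
    (hm : m = n ∨ n = m + 1) : Antitone z ∧ Antitone y := by
  have step : ∀ {r : ℕ} (x : Fin r → ℕ), (∀ i j : Fin r, j.val = i.val + 1 → x j ≤ x i) →
      Antitone x := by
    intro r x hx
    cases r with
    | zero => exact fun i => Fin.elim0 i
    | succ r => exact Fin.antitone_iff_succ_le.2 fun i => hx _ _ rfl
  exact ⟨step z fun i j hij => (h.1 j ⟨j, by omega⟩ rfl).trans (h.2 i ⟨j, by omega⟩ hij),
    step y fun i j hij => (h.2 ⟨i, by omega⟩ j hij).trans (h.1 ⟨i, by omega⟩ i rfl)⟩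

theorem count_ne_zero_of_interlaced_left {k : ℕ} {v : Fin (k / 2) → ℕ} {u : Fin ((k + 1) / 2) → ℕ}
    (h : Interlaced v u) : (count k u : ℝ) ≠ 0 := by
  exact_mod_cast (count_pos k u (antitone_of_interlaced h (by omega)).2).ne'

/-- `link k y` is a probability law, by the branching rule. -/
theorem sum_link {k : ℕ} {y : Fin ((k + 2) / 2) → ℕ} (hy : count (k + 1) y ≠ 0) :
    ∑' u, ENNReal.ofReal (link k y u) = 1 := by
  have hle : (k + 1) / 2 ≤ (k + 2) / 2 := by omega
  have hy' : (count (k + 1) y : ℝ) ≠ 0 := by exact_mod_cast hy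
  rw [tsum_eq_sum (s := below ((k + 1) / 2) y),
    ← ENNReal.ofReal_sum_of_nonneg fun u _ => link_nonneg k y u, ← ENNReal.ofReal_one]
  · congr 1
    rw [← div_self hy']
    nth_rewrite 1 [count_succ]
    rw [Nat.cast_sum, Finset.sum_div]
    apply Finset.sum_congr rfl
    intro u hu
    rw [link, if_pos ((mem_below hle).1 hu), Nat.cast_mul]
  · intro u hu
    rw [link, if_neg fun h => hu ((mem_below hle).2 h), ENNReal.ofReal_zero]

/-- The intertwining `Λ_k (S_k ⊗ step) = S_{k+1} Λ_k`: if row `k` is distributed as in a uniform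
pattern above `y` and then moves together with row `k + 1`, it is distributed in this way again
given the new state `(z, y')` of row `k + 1`, and row `k + 1` moves according to `S_{k+1}`. -/
theorem intertwining {q : ℝ} (hq : 0 < q) (hq1 : q < 1) (k : ℕ) (u' z : Fin ((k + 1) / 2) → ℕ)
    (y y' : Fin ((k + 2) / 2) → ℕ) :
    ∑' u, ∑' v : Fin (k / 2) → ℕ, ENNReal.ofReal (link k y u) *
      (ENNReal.ofReal (kern q k u (v, u')) * ENNReal.ofReal (stepProb q v u u' z y y')) =
    ENNReal.ofReal (kern q (k + 1) y (z, y')) * ENNReal.ofReal (link k y' u') := by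
  classical
  have hn : (k + 2) / 2 = k / 2 + 1 := by omega
  have hd : (k + 1) / 2 = k / 2 ∨ (k + 1) / 2 = k / 2 + 1 := by omega
  -- The numbers of patterns with last row `u` cancel.
  have hterm : ∀ u, ∀ v : Fin (k / 2) → ℕ, ENNReal.ofReal (link k y u) *
      (ENNReal.ofReal (kern q k u (v, u')) * ENNReal.ofReal (stepProb q v u u' z y y')) =
      ENNReal.ofReal ((count k u' : ℝ) / count (k + 1) y *
        ((if Interlaced u y then (signWeight (k / 2) u : ℝ) else 0) * rowKernel q v u u' *
          stepProb q v u u' z y y')) := by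
    intro u v
    rw [← ENNReal.ofReal_mul (kern_nonneg hq hq1 _ _ _), ← ENNReal.ofReal_mul (link_nonneg _ _ _)]
    congr 1
    by_cases h : rowKernel q v u u' = 0
    · simp [kern, h]
    · have hc := count_ne_zero_of_interlaced_left (interlaced_of_rowKernel_ne_zero h).1
      rw [kern, link]
      split_ifs
      · field_simp
      · ring
  have hnn : ∀ u, ∀ v : Fin (k / 2) → ℕ, 0 ≤ (count k u' : ℝ) / count (k + 1) y *
        ((if Interlaced u y then (signWeight (k / 2) u : ℝ) else 0) * rowKernel q v u u' *
          stepProb q v u u' z y y') := by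
    intro u v
    refine mul_nonneg (by positivity) (mul_nonneg (mul_nonneg ?_ (rowKernel_nonneg hq hq1 _ _ _))
      (stepProb_nonneg hq hq1 _ _ _ _ _ _))
    split_ifs <;> positivity
  -- Blocking confines `u` and `v` to a box, so that the series are finite sums.
  have hbox : ∀ u, ∀ v : Fin (k / 2) → ℕ, rowKernel q v u u' * stepProb q v u u' z y y' ≠ 0 →
      (∀ i, u i ≤ z i) ∧ ∀ i, v i ≤ coord z (i + 1) := by
    intro u v h
    have h1 : ∀ i, u i ≤ z i := by
      intro i
      by_contra hlt
      refine h ?_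
      rw [stepProb, Finset.prod_eq_zero (Finset.mem_univ i), zero_mul, mul_zero]
      rw [leftProb, if_neg fun h => hlt h.1, zero_mul]
    refine ⟨h1, fun i => ?_⟩
    have h2 := (interlaced_of_rowKernel_ne_zero (left_ne_zero_of_mul h)).1
    have hi : i.val < (k + 1) / 2 := by omega
    have e : coord z (i + 1) = z ⟨i, hi⟩ := coord_succ z ⟨i, hi⟩
    rw [e]
    exact (h2.1 i ⟨i, hi⟩ rfl).trans (h1 _)
  have hv : ∀ u, ∑' v : Fin (k / 2) → ℕ, ENNReal.ofReal (link k y u) *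
      (ENNReal.ofReal (kern q k u (v, u')) * ENNReal.ofReal (stepProb q v u u' z y y')) =
      ENNReal.ofReal (∑ v ∈ Fintype.piFinset
        (fun i : Fin (k / 2) => Finset.range (coord z (i + 1) + 1)),
        (count k u' : ℝ) / count (k + 1) y *
        ((if Interlaced u y then (signWeight (k / 2) u : ℝ) else 0) * rowKernel q v u u' *
          stepProb q v u u' z y y')) := by
    intro u
    simp only [hterm]
    rw [tsum_eq_sum, ENNReal.ofReal_sum_of_nonneg fun v _ => hnn u v]
    intro v hv
    by_contra hne
    apply hv
    simp only [Fintype.mem_piFinset, Finset.mem_range, Nat.lt_succ_iff]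
    refine (hbox u v fun h0 => hne ?_).2
    rw [mul_assoc _ (rowKernel q v u u'), h0, mul_zero, mul_zero, ENNReal.ofReal_zero]
  simp only [hv]
  rw [tsum_eq_sum (s := Fintype.piFinset (fun i => Finset.range (z i + 1))),
    ← ENNReal.ofReal_sum_of_nonneg fun u _ => Finset.sum_nonneg fun v _ => hnn u v]
  · simp only [← Finset.mul_sum]
    rw [row_sum_eq hq hq1 hd hn, ← ENNReal.ofReal_mul (kern_nonneg hq hq1 _ _ _)]
    congr 1
    by_cases h : rowKernel q z y y' = 0
    · simp [kern, h]
    · have hc : (count (k + 1) y' : ℝ) ≠ 0 :=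
        count_ne_zero_of_interlaced_left (k := k + 1) (interlaced_of_rowKernel_ne_zero h).2
      rw [kern, link]
      split_ifs
      · field_simp
      · ring
  · intro u hu
    by_contra hne
    apply hu
    simp only [Fintype.mem_piFinset, Finset.mem_range, Nat.lt_succ_iff]
    by_contra hu'
    apply hne
    rw [Finset.sum_eq_zero, ENNReal.ofReal_zero]
    intro v _
    by_contra hv0
    refine hu' (hbox u v fun h0 => hv0 ?_).1
    rw [mul_assoc _ (rowKernel q v u u'), h0, mul_zero, mul_zero]

open MeasureTheory ProbabilityTheory

/-! ### Jump probabilities of one particle -/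

section OneParticle

variable {Ω : Type*} [MeasurableSpace Ω] {μ : Measure Ω} [IsProbabilityMeasure μ] {q : ℝ}

/-- `a` is a geometric random variable with parameter `q`. -/
structure IsGeom (μ : Measure Ω) (q : ℝ) (a : Ω → ℕ) : Prop where
  measurable : Measurable a
  law : ∀ m : ℕ, μ {ω | a ω = m} = ENNReal.ofReal (q ^ m * (1 - q))

/-- The tails of a geometric variable. -/
theorem IsGeom.measure_ge {a : Ω → ℕ} (ha : IsGeom μ q a) (hq : 0 < q) (hq1 : q < 1) (n : ℕ) :
    μ {ω | n ≤ a ω} = ENNReal.ofReal (q ^ n) := by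
  induction n with
  | zero => simp
  | succ n ih =>
    have h1 : {ω | n ≤ a ω} = {ω | a ω = n} ∪ {ω | n + 1 ≤ a ω} := by
      ext ω; simp only [Set.mem_ofPred_eq, Set.mem_union]; omega
    have hm : MeasurableSet {ω | n + 1 ≤ a ω} := ha.measurable (measurableSet_Ici (a := n + 1))
    rw [h1, measure_union (Set.disjoint_left.2 fun ω h h' => by
      simp only [Set.mem_ofPred_eq] at h h'; omega) hm, ha.law] at ih
    have e : ENNReal.ofReal (q ^ n) = ENNReal.ofReal (q ^ n * (1 - q)) +
        ENNReal.ofReal (q ^ (n + 1)) := by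
      have : 0 ≤ 1 - q := by linarith
      rw [← ENNReal.ofReal_add (by positivity) (by positivity)]
      congr 1; ring
    rw [e] at ih
    exact (ENNReal.add_right_inj ENNReal.ofReal_ne_top).1 ih

theorem IsGeom.measure_left {a : Ω → ℕ} (ha : IsGeom μ q a) (hq : 0 < q) (hq1 : q < 1)
    {u x : ℕ} (hux : u ≤ x) (z : ℕ) :
    μ {ω | max u (x - a ω) = z} = ENNReal.ofReal (leftProb q u x z) := by
  rw [leftProb]
  split_ifs with h h'
  · have : {ω | max u (x - a ω) = z} = {ω | a ω = x - z} := by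
      ext ω; simp only [Set.mem_ofPred_eq]; omega
    rw [this, ha.law, ← zpow_natCast, Nat.cast_sub h.2]
  · have : {ω | max u (x - a ω) = z} = {ω | x - z ≤ a ω} := by
      ext ω; simp only [Set.mem_ofPred_eq]; omega
    rw [this, ha.measure_ge hq hq1, ← zpow_natCast, Nat.cast_sub h.2, mul_one]
  · have : {ω | max u (x - a ω) = z} = ∅ := by
      ext ω; simp only [Set.mem_ofPred_eq, Set.mem_empty_iff_false, iff_false]; omega
    rw [this, measure_empty, ENNReal.ofReal_zero]

/-- A particle that starts beyond the blocking position `c` is brought back to it, an event which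
`rightProb` does not account for; hence the hypothesis `hmc`. -/
theorem IsGeom.measure_right {b : Ω → ℕ} (hb : IsGeom μ q b) (hq : 0 < q) (hq1 : q < 1)
    {m c y : ℕ} (hmc : m ≤ c ∨ y < c) :
    μ {ω | min c (m + b ω) = y} = ENNReal.ofReal (rightProb q m c y) := by
  rw [rightProb]
  split_ifs with h h'
  · have : {ω | min c (m + b ω) = y} = {ω | b ω = y - m} := by
      ext ω; simp only [Set.mem_ofPred_eq]; omega
    rw [this, hb.law, ← zpow_natCast, Nat.cast_sub h.1]
  · have : {ω | min c (m + b ω) = y} = {ω | y - m ≤ b ω} := by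
      ext ω; simp only [Set.mem_ofPred_eq]; omega
    rw [this, hb.measure_ge hq hq1, ← zpow_natCast, Nat.cast_sub h.1, mul_one]
  · have : {ω | min c (m + b ω) = y} = ∅ := by
      ext ω; simp only [Set.mem_ofPred_eq, Set.mem_empty_iff_false, iff_false]; omega
    rw [this, measure_empty, ENNReal.ofReal_zero]

/-- The tails of the difference of two independent geometric variables. -/
theorem IsGeom.measure_add_le {a b : Ω → ℕ} (ha : IsGeom μ q a) (hb : IsGeom μ q b)
    (hab : IndepFun a b μ) (hq : 0 < q) (hq1 : q < 1) (d : ℕ) :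
    μ {ω | a ω + d ≤ b ω} = ENNReal.ofReal (q ^ d / (1 + q)) := by
  have h1 : {ω | a ω + d ≤ b ω} = ⋃ n, ({ω | a ω = n} ∩ {ω | n + d ≤ b ω}) := by
    ext ω
    simp only [Set.mem_ofPred_eq, Set.mem_iUnion, Set.mem_inter_iff]
    exact ⟨fun h => ⟨_, rfl, h⟩, fun ⟨n, h, h'⟩ => h ▸ h'⟩
  have hma : ∀ n, MeasurableSet {ω | a ω = n} := fun n => ha.measurable (measurableSet_singleton n)
  have hmb : ∀ n, MeasurableSet {ω | n ≤ b ω} := fun n => hb.measurable (measurableSet_Ici (a := n))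
  have hq0 : 0 ≤ 1 - q := by linarith
  have h1q : 1 - q ^ 2 ≠ 0 := by nlinarith
  rw [h1, measure_iUnion _ fun n => (hma n).inter (hmb _)]
  · have h2 : ∀ n, μ ({ω | a ω = n} ∩ {ω | n + d ≤ b ω}) =
        ENNReal.ofReal ((q ^ 2) ^ n * ((1 - q) * q ^ d)) := by
      intro n
      rw [hab.measure_inter_preimage_eq_mul {n} (Set.Ici (n + d)) (measurableSet_singleton n)
        measurableSet_Ici |> fun h => (show μ ({ω | a ω = n} ∩ {ω | n + d ≤ b ω}) =
          μ {ω | a ω = n} * μ {ω | n + d ≤ b ω} from h), ha.law, hb.measure_ge hq hq1,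
        ← ENNReal.ofReal_mul (by positivity)]
      congr 1
      ring
    have hsum := (hasSum_geometric_of_lt_one (sq_nonneg q) (by nlinarith)).mul_right ((1 - q) * q ^ d)
    simp only [h2]
    rw [← ENNReal.ofReal_tsum_of_nonneg (fun n => by positivity) hsum.summable, hsum.tsum_eq]
    congr 1
    field_simp
    ring
  · intro n m hnm
    exact Set.disjoint_left.2 fun ω h h' => hnm (h.1.symm.trans h'.1)

/-- The probabilities of the values of the difference of two independent geometric variables. -/
theorem IsGeom.measure_add_eq {a b : Ω → ℕ} (ha : IsGeom μ q a) (hb : IsGeom μ q b)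
    (hab : IndepFun a b μ) (hq : 0 < q) (hq1 : q < 1) (d : ℕ) :
    μ {ω | a ω + d = b ω} = ENNReal.ofReal ((1 - q) / (1 + q) * q ^ d) := by
  have hm : MeasurableSet {ω | a ω + (d + 1) ≤ b ω} :=
    measurableSet_le (ha.measurable.add_const (d + 1)) hb.measurable
  have h1 : {ω | a ω + d ≤ b ω} = {ω | a ω + d = b ω} ∪ {ω | a ω + (d + 1) ≤ b ω} := by
    ext ω; simp only [Set.mem_ofPred_eq, Set.mem_union]; omega
  have ih := ha.measure_add_le hb hab hq hq1 d
  rw [h1, measure_union (Set.disjoint_left.2 fun ω h h' => by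
    simp only [Set.mem_ofPred_eq] at h h'; omega) hm, ha.measure_add_le hb hab hq hq1] at ih
  have e : ENNReal.ofReal (q ^ d / (1 + q)) = ENNReal.ofReal ((1 - q) / (1 + q) * q ^ d) +
      ENNReal.ofReal (q ^ (d + 1) / (1 + q)) := by
    have : 0 ≤ 1 - q := by linarith
    rw [← ENNReal.ofReal_add (by positivity) (by positivity)]
    congr 1; field_simp; ring
  rw [e] at ih
  exact (ENNReal.add_left_inj ENNReal.ofReal_ne_top).1 ih

/-- The law of a reflected and blocked particle. -/
theorem IsGeom.measure_refl {a b : Ω → ℕ} (ha : IsGeom μ q a) (hb : IsGeom μ q b)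
    (hab : IndepFun a b μ) (hq : 0 < q) (hq1 : q < 1) {x c : ℕ} (hxc : x ≤ c) (y : ℕ) :
    μ {ω | min c ((x : ℤ) + b ω - a ω).natAbs = y} = ENNReal.ofReal (reflProb q x c y) := by
  have hq0 : 0 ≤ 1 - q := by linarith
  have hba := hab.symm
  have hmle : MeasurableSet {ω | b ω + (x + c) ≤ a ω} :=
    measurableSet_le (hb.measurable.add_const _) ha.measurable
  have hmeq : MeasurableSet {ω | b ω + (x + y) = a ω} :=
    measurableSet_eq_fun (hb.measurable.add_const _) ha.measurable
  rw [reflProb, R]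
  split_ifs with h1 h2 h2 h3
  · -- The position `0` is reached in one way only.
    subst h2
    have : {ω | min c ((x : ℤ) + b ω - a ω).natAbs = 0} = {ω | b ω + x = a ω} := by
      ext ω; simp only [Set.mem_ofPred_eq]; omega
    rw [this, hb.measure_add_eq ha hba hq hq1]
  · rcases le_total x y with hxy | hxy
    · have : {ω | min c ((x : ℤ) + b ω - a ω).natAbs = y} =
          {ω | a ω + (y - x) = b ω} ∪ {ω | b ω + (x + y) = a ω} := by
        ext ω; simp only [Set.mem_ofPred_eq, Set.mem_union]; omega
      rw [this, measure_union (Set.disjoint_left.2 fun ω h h' => by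
        simp only [Set.mem_ofPred_eq] at h h'; omega) hmeq, hb.measure_add_eq ha hba hq hq1,
        ha.measure_add_eq hb hab hq hq1, ← ENNReal.ofReal_add (by positivity) (by positivity)]
      rw [← mul_add, show ((x : ℤ) - y).natAbs = y - x by omega]
    · have : {ω | min c ((x : ℤ) + b ω - a ω).natAbs = y} =
          {ω | b ω + (x - y) = a ω} ∪ {ω | b ω + (x + y) = a ω} := by
        ext ω; simp only [Set.mem_ofPred_eq, Set.mem_union]; omega
      rw [this, measure_union (Set.disjoint_left.2 fun ω h h' => by
        simp only [Set.mem_ofPred_eq] at h h'; omega) hmeq, hb.measure_add_eq ha hba hq hq1,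
        hb.measure_add_eq ha hba hq hq1, ← ENNReal.ofReal_add (by positivity) (by positivity)]
      rw [← mul_add, show ((x : ℤ) - y).natAbs = x - y by omega]
  · subst h2 h3
    have : {ω | min 0 ((x : ℤ) + b ω - a ω).natAbs = 0} = Set.univ := by
      ext ω; simp
    rw [this, measure_univ, ENNReal.ofReal_one]
  · subst h2
    have : {ω | min y ((x : ℤ) + b ω - a ω).natAbs = y} =
          {ω | a ω + (y - x) ≤ b ω} ∪ {ω | b ω + (x + y) ≤ a ω} := by
      ext ω; simp only [Set.mem_ofPred_eq, Set.mem_union]; omega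
    rw [this, measure_union (Set.disjoint_left.2 fun ω h h' => by
        simp only [Set.mem_ofPred_eq] at h h'; omega) hmle, hb.measure_add_le ha hba hq hq1,
        ha.measure_add_le hb hab hq hq1, ← ENNReal.ofReal_add (by positivity) (by positivity)]
    congr 1
    rw [← zpow_natCast, ← zpow_natCast, Nat.cast_sub hxc]
    push_cast
    rw [add_comm (x : ℤ), add_div]
  · have : {ω | min c ((x : ℤ) + b ω - a ω).natAbs = y} = ∅ := by
      ext ω; simp only [Set.mem_ofPred_eq, Set.mem_empty_iff_false, iff_false]; omega
    rw [this, measure_empty, ENNReal.ofReal_zero]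

end OneParticle

/-! ### The dynamics of one row given the previous one -/

/-- The next state `(z, y')` of row `l + 1`, from its position `y`, the positions `u`, `v`, `u'` of
row `l` at the times `n`, `n + 1/2` and `n + 1`, and the jump sizes of row `l + 1`. -/
def nextRow (l : ℕ) (v : Fin (l / 2) → ℕ) (u u' : Fin ((l + 1) / 2) → ℕ)
    (y : Fin ((l + 2) / 2) → ℕ) (a b : ℕ → ℕ) : PairState (l + 1) :=
  let pushed (i : ℕ) : ℕ := if i = 0 then coord y 1 else min (coord y (i + 1)) (coord v i)
  let half (i : ℕ) : ℕ := max (coord u (i + 1)) (pushed i - a (i + 1))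
  let target (i : ℕ) : ℕ :=
    if i < (l + 1) / 2 then max (coord u' (i + 1)) (half i) + b (i + 1)
    else ((pushed i : ℤ) + b (i + 1) - a (i + 1)).natAbs
  (fun i => half i, fun i => if i.val = 0 then target i else min (coord v i) (target i))

theorem coord_Y (ξ : ℕ → ℕ → ℕ → ℕ) (l n : ℕ) {i : ℕ} (h1 : 1 ≤ i) (h2 : i ≤ (l + 1) / 2) :
    coord (Y ξ l n) i = X ξ n l i := by
  rw [coord, dif_pos ⟨h1, h2⟩]
  change X ξ n l (i - 1 + 1) = _
  rw [Nat.sub_add_cancel h1]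

theorem coord_Z (ξ : ℕ → ℕ → ℕ → ℕ) (l n : ℕ) {i : ℕ} (h1 : 1 ≤ i) (h2 : i ≤ l / 2) :
    coord (Z ξ l (n + 1)) i = Xhalf ξ n l i := by
  rw [coord, dif_pos ⟨h1, h2⟩]
  change Xhalf ξ n l (i - 1 + 1) = _
  rw [Nat.sub_add_cancel h1]

theorem Xhalf_succ (ξ : ℕ → ℕ → ℕ → ℕ) (l n i : ℕ) : Xhalf ξ n (l + 1) i =
    if i ≤ (l + 1) / 2 then max (X ξ n l i)
      ((if i = 1 then X ξ n (l + 1) i else min (X ξ n (l + 1) i) (Xhalf ξ n l (i - 1))) -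
        ξ (2 * n + 1) (l + 1) i)
    else if i = 1 then X ξ n (l + 1) i else min (X ξ n (l + 1) i) (Xhalf ξ n l (i - 1)) := rfl

theorem X_succ (ξ : ℕ → ℕ → ℕ → ℕ) (l n i : ℕ) : X ξ (n + 1) (l + 1) i =
    if i = 1 then
      if i ≤ (l + 1) / 2 then max (X ξ (n + 1) l i) (Xhalf ξ n (l + 1) i) + ξ (2 * n + 2) (l + 1) i
      else ((Xhalf ξ n (l + 1) i : ℤ) + ξ (2 * n + 2) (l + 1) i - ξ (2 * n + 1) (l + 1) i).natAbs
    else min (Xhalf ξ n l (i - 1))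
      (if i ≤ (l + 1) / 2 then max (X ξ (n + 1) l i) (Xhalf ξ n (l + 1) i) + ξ (2 * n + 2) (l + 1) i
      else ((Xhalf ξ n (l + 1) i : ℤ) + ξ (2 * n + 2) (l + 1) i
        - ξ (2 * n + 1) (l + 1) i).natAbs) := rfl

/-- Row `l + 1` evolves autonomously, given row `l` and its own jump sizes. -/
theorem next_eq_nextRow (ξ : ℕ → ℕ → ℕ → ℕ) (l n : ℕ) :
    (Z ξ (l + 1) (n + 1), Y ξ (l + 1) (n + 1)) =
      nextRow l (Z ξ l (n + 1)) (Y ξ l n) (Y ξ l (n + 1)) (Y ξ (l + 1) n)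
        (ξ (2 * n + 1) (l + 1)) (ξ (2 * n + 2) (l + 1)) := by
  have hpush : ∀ i, i < (l + 2) / 2 → (if i = 0 then coord (Y ξ (l + 1) n) 1
      else min (coord (Y ξ (l + 1) n) (i + 1)) (coord (Z ξ l (n + 1)) i)) =
      if i + 1 = 1 then X ξ n (l + 1) (i + 1)
        else min (X ξ n (l + 1) (i + 1)) (Xhalf ξ n l (i + 1 - 1)) := by
    intro i hi
    rw [coord_Y ξ (l + 1) n (i := i + 1) (by omega) (by omega)]
    rcases Nat.eq_zero_or_pos i with rfl | h
    · rw [if_pos rfl, if_pos rfl, coord_Y ξ (l + 1) n (by omega) (by omega)]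
    · rw [if_neg (by omega), if_neg (by omega), coord_Z ξ l n (by omega) (by omega),
        Nat.add_sub_cancel]
  have hhalf : ∀ i, i < (l + 1) / 2 → max (coord (Y ξ l n) (i + 1))
      ((if i = 0 then coord (Y ξ (l + 1) n) 1
        else min (coord (Y ξ (l + 1) n) (i + 1)) (coord (Z ξ l (n + 1)) i)) -
          ξ (2 * n + 1) (l + 1) (i + 1)) = Xhalf ξ n (l + 1) (i + 1) := by
    intro i hi
    rw [hpush i (by omega), Xhalf_succ, if_pos (show i + 1 ≤ (l + 1) / 2 from hi),
      coord_Y ξ l n (by omega) (by omega)]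
  ext i
  · exact (hhalf i i.2).symm
  · simp only [nextRow, Y]
    have hi := i.2
    rw [X_succ]
    by_cases hd : i.val < (l + 1) / 2
    · rw [if_pos (show i.val + 1 ≤ (l + 1) / 2 from hd), if_pos hd, hhalf i hd,
        coord_Y ξ l (n + 1) (by omega) (by omega)]
      rcases Nat.eq_zero_or_pos i.val with h0 | h
      · rw [if_pos (by omega), if_pos h0]
      · rw [if_neg (by omega), if_neg (by omega), coord_Z ξ l n (by omega) (by omega),
          Nat.add_sub_cancel]
    · rw [if_neg (show ¬ i.val + 1 ≤ (l + 1) / 2 from hd), if_neg hd, hpush i (by omega),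
        Xhalf_succ, if_neg (show ¬ i.val + 1 ≤ (l + 1) / 2 from hd)]
      rcases Nat.eq_zero_or_pos i.val with h0 | h
      · rw [if_pos (by omega : i.val = 0), if_pos (by omega : i.val + 1 = 1)]
      · rw [if_neg (by omega : ¬ i.val + 1 = 1), if_neg (by omega : ¬ i.val = 0),
          coord_Z ξ l n (by omega) (by omega), Nat.add_sub_cancel]

/-! ### Interlacing along the dynamics -/

/-- If the rows of the configuration interlace at time `n`, then each row at time `n + 1/2`
interlaces with itself at the times `n` and `n + 1`. -/
theorem interlacing_step (ξ : ℕ → ℕ → ℕ → ℕ) (n : ℕ)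
    (hI : ∀ l i, 1 ≤ i → (i ≤ (l + 1) / 2 → X ξ n l i ≤ X ξ n (l + 1) i) ∧
      (i + 1 ≤ (l + 2) / 2 → X ξ n (l + 1) (i + 1) ≤ X ξ n l i)) (l : ℕ) :
    (∀ i, 1 ≤ i → i ≤ l / 2 → Xhalf ξ n l i ≤ X ξ n l i ∧ Xhalf ξ n l i ≤ X ξ (n + 1) l i) ∧
    (∀ i, 1 ≤ i → i + 1 ≤ (l + 1) / 2 → X ξ n l (i + 1) ≤ Xhalf ξ n l i ∧
      X ξ (n + 1) l (i + 1) ≤ Xhalf ξ n l i) := by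
  induction l with
  | zero => exact ⟨fun i h1 h2 => by omega, fun i h1 h2 => by omega⟩
  | succ l ih =>
    obtain ⟨ih1, ih2⟩ := ih
    have hhalf : ∀ i, 1 ≤ i → i ≤ (l + 1) / 2 → X ξ n l i ≤ Xhalf ξ n (l + 1) i := by
      intro i h1 h2
      rw [Xhalf_succ, if_pos h2]
      exact le_max_left _ _
    refine ⟨fun i h1 h2 => ⟨?_, ?_⟩, fun i h1 h2 => ⟨?_, ?_⟩⟩
    · have := (hI l i h1).1 h2
      rw [Xhalf_succ, if_pos h2]
      split_ifs <;> omega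
    · have hup : i ≠ 1 → Xhalf ξ n (l + 1) i ≤ Xhalf ξ n l (i - 1) := by
        intro hi
        have := (ih2 (i - 1) (by omega) (by omega)).1
        rw [Nat.sub_add_cancel h1] at this
        rw [Xhalf_succ, if_pos h2, if_neg hi]
        omega
      rw [X_succ, if_pos h2]
      split_ifs with hi
      · omega
      · have := hup hi
        omega
    · exact ((hI l i h1).2 h2).trans (hhalf i h1 (by omega))
    · have h3 := (ih1 i h1 (by omega)).1.trans (hhalf i h1 (by omega))
      rw [X_succ, if_neg (by omega : ¬ i + 1 = 1), Nat.add_sub_cancel]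
      omega

/-- Consecutive rows of the configuration interlace at all integer times. -/
theorem interlacing (ξ : ℕ → ℕ → ℕ → ℕ) (n l i : ℕ) (hi : 1 ≤ i) :
    (i ≤ (l + 1) / 2 → X ξ n l i ≤ X ξ n (l + 1) i) ∧
      (i + 1 ≤ (l + 2) / 2 → X ξ n (l + 1) (i + 1) ≤ X ξ n l i) := by
  induction n generalizing l i with
  | zero => exact ⟨fun _ => le_rfl, fun _ => le_rfl⟩
  | succ n ih =>
    obtain ⟨h1, h2⟩ := interlacing_step ξ n ih l
    refine ⟨fun h => ?_, fun h => ?_⟩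
    · rw [X_succ, if_pos h]
      split_ifs with h'
      · omega
      · have := (h2 (i - 1) (by omega) (by omega)).2
        rw [Nat.sub_add_cancel hi] at this
        omega
    · have := (h1 i hi (by omega)).2
      rw [X_succ, if_neg (by omega : ¬ i + 1 = 1), Nat.add_sub_cancel]
      omega

theorem mem_WplusPair_of_interlaced {k : ℕ} {p : PairState k} (h : Interlaced p.1 p.2) :
    p ∈ WplusPair k := by
  have h' := antitone_of_interlaced h (by omega)
  exact ⟨h'.1, h'.2, h⟩

theorem state_mem (ξ : ℕ → ℕ → ℕ → ℕ) (k n : ℕ) :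
    (Z ξ k (n + 1), Y ξ k (n + 1)) ∈ WplusPair k := by
  obtain ⟨h1, h2⟩ := interlacing_step ξ n (fun l i => interlacing ξ n l i) k
  refine mem_WplusPair_of_interlaced ⟨fun i j hij => ?_, fun i j hij => ?_⟩
  · have := (h1 (i + 1) (by omega) (by omega)).2
    rw [← hij] at this
    simpa only [Z, Y, hij] using this
  · have := (h2 (i + 1) (by omega) (by omega)).2
    simpa only [Z, Y, hij] using this

/-! ### Measurability -/

section Measurability

variable {Ω : Type*} [MeasurableSpace Ω] {ξ : ℕ → ℕ → ℕ → Ω → ℕ}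

/-- The configuration `X(n)` for the random jump sizes `ξ`. -/
abbrev RX (ξ : ℕ → ℕ → ℕ → Ω → ℕ) (n l i : ℕ) (ω : Ω) : ℕ := X (fun t l i => ξ t l i ω) n l i

/-- The configuration `X(n + 1/2)` for the random jump sizes `ξ`. -/
abbrev RXhalf (ξ : ℕ → ℕ → ℕ → Ω → ℕ) (n l i : ℕ) (ω : Ω) : ℕ :=
  Xhalf (fun t l i => ξ t l i ω) n l i

/-- The state `(Z^k(n), Y^k(n))` for the random jump sizes `ξ`. -/
def W (ξ : ℕ → ℕ → ℕ → Ω → ℕ) (k n : ℕ) (ω : Ω) : PairState k :=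
  (Z (fun t l i => ξ t l i ω) k n, Y (fun t l i => ξ t l i ω) k n)

theorem measurable_Xhalf_of {n l : ℕ}
    (hX : ∀ l' ≤ l, ∀ i, 1 ≤ i → i ≤ (l' + 1) / 2 → Measurable (RX ξ n l' i))
    (hξ : ∀ l' i, 1 ≤ l' → l' ≤ l → 1 ≤ i → i ≤ (l' + 1) / 2 → Measurable (ξ (2 * n + 1) l' i))
    (i : ℕ) (h1 : 1 ≤ i) (h2 : i ≤ (l + 1) / 2) : Measurable (RXhalf ξ n l i) := by
  induction l generalizing i with
  | zero => omega
  | succ l ih =>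
    have hp : Measurable fun ω => if i = 1 then RX ξ n (l + 1) i ω
        else min (RX ξ n (l + 1) i ω) (RXhalf ξ n l (i - 1) ω) := by
      split_ifs with hi
      · exact hX _ le_rfl i h1 h2
      · exact (hX _ le_rfl i h1 h2).min (ih (fun l' h => hX l' (by omega))
          (fun l' i h h' => hξ l' i h (by omega)) (i - 1) (by omega) (by omega))
    change Measurable fun ω => Xhalf (fun t l i => ξ t l i ω) n (l + 1) i
    simp only [Xhalf_succ]
    by_cases hd : i ≤ (l + 1) / 2
    · simp only [if_pos hd]
      exact (hX l (by omega) i h1 hd).max (hp.sub (hξ (l + 1) i (by omega) le_rfl h1 h2))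
    · simp only [if_neg hd]
      exact hp

theorem measurable_X_of {n l : ℕ}
    (hξ : ∀ t l' i, 1 ≤ t → t ≤ 2 * n → 1 ≤ l' → l' ≤ l → 1 ≤ i → i ≤ (l' + 1) / 2 →
      Measurable (ξ t l' i))
    (i : ℕ) (h1 : 1 ≤ i) (h2 : i ≤ (l + 1) / 2) : Measurable (RX ξ n l i) := by
  induction n generalizing l i with
  | zero => exact measurable_const
  | succ n ihn =>
    have hhalf : ∀ l' ≤ l, ∀ i, 1 ≤ i → i ≤ (l' + 1) / 2 → Measurable (RXhalf ξ n l' i) := by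
      intro l' hl' i h1 h2
      refine measurable_Xhalf_of (fun l'' hl'' i h1 h2 => ihn (fun t l' i ht ht' h h' =>
        hξ t l' i ht (by omega) h (by omega)) i h1 h2)
        (fun l'' i h h' => hξ _ l'' i (by omega) (by omega) h (by omega)) i h1 h2
    induction l generalizing i with
    | zero => omega
    | succ l ih =>
      have ha := hξ (2 * n + 1) (l + 1) i (by omega) (by omega) (by omega) le_rfl h1 h2
      have hb := hξ (2 * n + 2) (l + 1) i (by omega) (by omega) (by omega) le_rfl h1 h2
      have hh := hhalf (l + 1) le_rfl i h1 h2
      have ht : Measurable fun ω => if i ≤ (l + 1) / 2 then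
          max (RX ξ (n + 1) l i ω) (RXhalf ξ n (l + 1) i ω) + ξ (2 * n + 2) (l + 1) i ω
          else ((RXhalf ξ n (l + 1) i ω : ℤ) + ξ (2 * n + 2) (l + 1) i ω -
            ξ (2 * n + 1) (l + 1) i ω).natAbs := by
        split_ifs with hd
        · exact ((ih (fun t l' i h1 h2 h3 h4 => hξ t l' i h1 h2 h3 (by omega)) i h1 hd
            (fun l' hl' => hhalf l' (by omega))).max hh).add hb
        · exact (Measurable.of_discrete (f := fun x : ℕ × ℕ × ℕ =>
            ((x.1 : ℤ) + x.2.1 - x.2.2).natAbs)).comp (hh.prodMk (hb.prodMk ha))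
      change Measurable fun ω => X (fun t l i => ξ t l i ω) (n + 1) (l + 1) i
      simp only [X_succ]
      by_cases hi : i = 1
      · simp only [if_pos hi]
        exact ht
      · simp only [if_neg hi]
        exact (hhalf l (by omega) (i - 1) (by omega) (by omega)).min ht

/-- The state of row `l` at time `n` involves only jump sizes of the rows up to `l` and the times up
to `n`. -/
theorem measurable_W_of {n l : ℕ}
    (hξ : ∀ t l' i, 1 ≤ t → t ≤ 2 * n → 1 ≤ l' → l' ≤ l → 1 ≤ i → i ≤ (l' + 1) / 2 →
      Measurable (ξ t l' i)) : Measurable (W ξ l n) := by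
  refine Measurable.prodMk ?_ ?_
  · cases n with
    | zero => exact measurable_const
    | succ n =>
      refine measurable_pi_lambda _ fun j => ?_
      refine measurable_Xhalf_of (fun l' hl' i h1 h2 => measurable_X_of
        (fun t l'' i ht ht' h h' => hξ t l'' i ht (by omega) h (by omega)) i h1 h2)
        (fun l'' i h h' => hξ _ l'' i (by omega) (by omega) h (by omega)) _ (by omega) (by omega)
  · exact measurable_pi_lambda _ fun j => measurable_X_of hξ _ (by omega) (by omega)

end Measurability

/-! ### Independence -/

section Noise

variable {Ω : Type*}

/-- The jump sizes of the model with `k` rows are independent geometric variables. -/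
structure IsNoise [MeasurableSpace Ω] (μ : Measure Ω) (q : ℝ) (k : ℕ)
    (ξ : ℕ → ℕ → ℕ → Ω → ℕ) : Prop where
  geom : ∀ p ∈ JumpIndex k, IsGeom μ q (ξ p.1 p.2.1 p.2.2)
  indep : iIndepFun (fun p : JumpIndex k => ξ p.val.1 p.val.2.1 p.val.2.2) μ

/-- The `σ`-algebra generated by the jump sizes with label in `A`. -/
@[reducible] def hist (k : ℕ) (ξ : ℕ → ℕ → ℕ → Ω → ℕ) (A : Set (ℕ × ℕ × ℕ)) : MeasurableSpace Ω :=
  ⨆ p ∈ {p : JumpIndex k | p.val ∈ A},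
    MeasurableSpace.comap (ξ p.val.1 p.val.2.1 p.val.2.2) inferInstance

variable {k : ℕ} {ξ : ℕ → ℕ → ℕ → Ω → ℕ}

theorem measurable_hist {A : Set (ℕ × ℕ × ℕ)} {p : ℕ × ℕ × ℕ} (hp : p ∈ JumpIndex k) (hA : p ∈ A) :
    Measurable[hist k ξ A] (ξ p.1 p.2.1 p.2.2) := by
  rw [measurable_iff_comap_le]
  exact le_biSup (f := fun p : JumpIndex k => MeasurableSpace.comap
    (ξ p.val.1 p.val.2.1 p.val.2.2) inferInstance)
    (show (⟨p, hp⟩ : JumpIndex k) ∈ {p : JumpIndex k | p.val ∈ A} from hA)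

theorem hist_mono {A B : Set (ℕ × ℕ × ℕ)} (h : A ⊆ B) : hist k ξ A ≤ hist k ξ B :=
  biSup_mono fun _ hp => h hp

variable [mΩ : MeasurableSpace Ω] {μ : Measure Ω} {q : ℝ}

theorem IsNoise.hist_le (hN : IsNoise μ q k ξ) (A : Set (ℕ × ℕ × ℕ)) : hist k ξ A ≤ mΩ :=
  iSup₂_le fun (p : JumpIndex k) _ => (hN.geom p.1 p.2).measurable.comap_le

theorem IsNoise.indep_hist (hN : IsNoise μ q k ξ) {A B : Set (ℕ × ℕ × ℕ)} (h : Disjoint A B) :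
    Indep (hist k ξ A) (hist k ξ B) μ :=
  indep_iSup_of_disjoint (m := fun p : JumpIndex k => MeasurableSpace.comap
      (ξ p.val.1 p.val.2.1 p.val.2.2) inferInstance)
    (S := {p : JumpIndex k | p.val ∈ A}) (T := {p : JumpIndex k | p.val ∈ B})
    (fun p => (hN.geom p.1 p.2).measurable.comap_le) (iIndepFun.iIndep hN.indep)
    (Set.disjoint_left.2 fun p (h1 : p.val ∈ A) (h2 : p.val ∈ B) => Set.disjoint_left.1 h h1 h2)

/-- Events depending on disjoint groups of jump sizes are independent. -/
theorem IsNoise.measure_biInter (hN : IsNoise μ q k ξ) [IsProbabilityMeasure μ] (n : ℕ)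
    (A : ℕ → Set (ℕ × ℕ × ℕ))
    (hA : ∀ i j, i ≠ j → Disjoint (A i) (A j)) (E : ℕ → Set Ω)
    (hE : ∀ i < n, MeasurableSet[hist k ξ (A i)] (E i)) :
    μ (⋂ i ∈ Finset.range n, E i) = ∏ i ∈ Finset.range n, μ (E i) := by
  induction n with
  | zero => simp
  | succ n ih =>
    rw [Finset.prod_range_succ, ← ih fun i hi => hE i (by omega)]
    have h1 : ⋂ i ∈ Finset.range (n + 1), E i = (⋂ i ∈ Finset.range n, E i) ∩ E n := by
      rw [Finset.range_add_one, Finset.set_biInter_insert, Set.inter_comm]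
    rw [h1]
    have hd : Disjoint (⋃ i ∈ Finset.range n, A i) (A n) := by
      simp only [Set.disjoint_iUnion_left]
      intro i hi
      exact hA i n (Finset.mem_range.1 hi).ne
    refine (Indep_iff _ _ μ).1 (hN.indep_hist hd) _ _ ?_ (hE n (by omega))
    refine Finset.measurableSet_biInter _ fun i hi => ?_
    exact hist_mono (Set.subset_biUnion_of_mem (u := A) hi) _
      (hE i (by have := Finset.mem_range.1 hi; omega))

end Noise

/-! ### The transition probabilities of one row given the previous one -/

section Step

variable {Ω : Type*} [mΩ : MeasurableSpace Ω] {μ : Measure Ω} [IsProbabilityMeasure μ] {q : ℝ}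
  {k : ℕ} {ξ : ℕ → ℕ → ℕ → Ω → ℕ}

omit mΩ in
theorem measurableSet_hist_pair {A : Set (ℕ × ℕ × ℕ)} {p p' : ℕ × ℕ × ℕ} (hp : p ∈ JumpIndex k)
    (hp' : p' ∈ JumpIndex k) (hA : p ∈ A) (hA' : p' ∈ A) (E : Set (ℕ × ℕ)) :
    MeasurableSet[hist k ξ A] {ω | (ξ p.1 p.2.1 p.2.2 ω, ξ p'.1 p'.2.1 p'.2.2 ω) ∈ E} := by
  have h : Measurable[hist k ξ A] fun ω => (ξ p.1 p.2.1 p.2.2 ω, ξ p'.1 p'.2.1 p'.2.2 ω) :=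
    Measurable.prodMk (measurable_hist (ξ := ξ) hp hA) (measurable_hist (ξ := ξ) hp' hA')
  exact h MeasurableSet.of_discrete

omit [IsProbabilityMeasure μ] in
theorem IsNoise.indepFun (hN : IsNoise μ q k ξ) {p p' : ℕ × ℕ × ℕ} (hp : p ∈ JumpIndex k)
    (hp' : p' ∈ JumpIndex k) (hne : p ≠ p') :
    IndepFun (ξ p.1 p.2.1 p.2.2) (ξ p'.1 p'.2.1 p'.2.2) μ :=
  iIndepFun.indepFun hN.indep (i := ⟨p, hp⟩) (j := ⟨p', hp'⟩) fun h => hne (congrArg Subtype.val h)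

/-- The values of the jump sizes `(a, b)` of the particle `i + 1` of a row for which it moves
from `y` through `z` to `y'`. -/
def jumpSet {p d n : ℕ} (v : Fin p → ℕ) (u u' z : Fin d → ℕ) (y y' : Fin n → ℕ) (i : ℕ) :
    Set (ℕ × ℕ) :=
  {ab | if i < d then
      max (coord u (i + 1)) (min (coord y (i + 1)) (barrier v y y' i) - ab.1) = coord z (i + 1) ∧
      min (barrier v y y' i) (max (coord u' (i + 1)) (coord z (i + 1)) + ab.2) = coord y' (i + 1)
    else min (barrier v y y' i) (((min (coord y (i + 1)) (barrier v y y' i) : ℕ) : ℤ) + ab.2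
      - ab.1).natAbs = coord y' (i + 1)}

/-- The particles of a row jump separately, given the motion of the previous row. -/
theorem nextRow_eq_iff {l : ℕ} (v : Fin (l / 2) → ℕ) (u u' z : Fin ((l + 1) / 2) → ℕ)
    (y y' : Fin ((l + 2) / 2) → ℕ) (a b : ℕ → ℕ) :
    nextRow l v u u' y a b = (z, y') ↔
      ∀ i < (l + 2) / 2, (a (i + 1), b (i + 1)) ∈ jumpSet v u u' z y y' i := by
  have hpush : ∀ i, (if i = 0 then coord y 1 else min (coord y (i + 1)) (coord v i)) =
      min (coord y (i + 1)) (barrier v y y' i) := by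
    intro i
    rw [barrier]
    split_ifs with h
    · subst h; rw [zero_add]; omega
    · rfl
  have hbar : ∀ i t, (if i = 0 then t else min (coord v i) t) = coord y' (i + 1) ↔
      min (barrier v y y' i) t = coord y' (i + 1) := by
    intro i t
    rw [barrier]
    split_ifs with h
    · subst h; rw [zero_add]; omega
    · rfl
  simp only [nextRow, Prod.mk.injEq, funext_iff, jumpSet, Set.mem_ofPred_eq, hpush]
  have hz : ∀ i : Fin ((l + 1) / 2), z i = coord z (i + 1) := fun i => (coord_succ z i).symm
  have hy : ∀ i : Fin ((l + 1 + 1) / 2), y' i = coord y' (i + 1) := fun i => (coord_succ y' i).symm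
  simp only [hz, hy, hbar]
  constructor
  · rintro ⟨h1, h2⟩ i hi
    have h2' := h2 ⟨i, hi⟩
    split_ifs at h2' ⊢ with hd
    · have h1' := h1 ⟨i, hd⟩
      simp only at h1' h2'
      rw [h1'] at h2'
      exact ⟨h1', h2'⟩
    · exact h2'
  · intro h
    refine ⟨fun i => ?_, fun i => ?_⟩
    · have := h i (by omega)
      rw [if_pos i.2] at this
      exact this.1
    · have := h i i.2
      split_ifs at this ⊢ with hd
      · rw [this.1]; exact this.2
      · exact this

/-- The transition probability of a particle that is not reflected. Interlacing ensures that the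
neighbours at which the particle is blocked lie on the correct side of it. -/
theorem IsNoise.measure_jumpSet_ordinary (hN : IsNoise μ q k ξ) (hq : 0 < q) (hq1 : q < 1)
    {l : ℕ} (n : ℕ) (hl : l + 1 ≤ k) {v : Fin (l / 2) → ℕ} {u u' : Fin ((l + 1) / 2) → ℕ}
    (z : Fin ((l + 1) / 2) → ℕ) {y : Fin ((l + 2) / 2) → ℕ} (y' : Fin ((l + 2) / 2) → ℕ)
    (huy : Interlaced u y) (hvu : Interlaced v u) (hvu' : Interlaced v u') (i : ℕ)
    (hi : i < (l + 1) / 2) :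
    μ {ω | (ξ (2 * n + 1) (l + 1) (i + 1) ω, ξ (2 * n + 2) (l + 1) (i + 1) ω) ∈
      jumpSet v u u' z y y' i} =
    ENNReal.ofReal (leftProb q (coord u (i + 1)) (min (coord y (i + 1)) (barrier v y y' i))
        (coord z (i + 1)) * rightProb q (max (coord u' (i + 1)) (coord z (i + 1)))
        (barrier v y y' i) (coord y' (i + 1))) := by
  have ha : (2 * n + 1, l + 1, i + 1) ∈ JumpIndex k :=
    ⟨by simp, ⟨by simp, hl⟩, ⟨by simp, by simp only; omega⟩⟩
  have hb : (2 * n + 2, l + 1, i + 1) ∈ JumpIndex k :=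
    ⟨by simp, ⟨by simp, hl⟩, ⟨by simp, by simp only; omega⟩⟩
  have hind := hN.indepFun ha hb (by simp)
  simp only [jumpSet, Set.mem_ofPred_eq, if_pos hi]
  have hux : coord u (i + 1) ≤ min (coord y (i + 1)) (barrier v y y' i) := by
    have e1 : coord u (i + 1) = u ⟨i, hi⟩ := coord_succ u ⟨i, hi⟩
    have e2 : coord y (i + 1) = y ⟨i, by omega⟩ := coord_succ y ⟨i, by omega⟩
    have h1 := huy.1 ⟨i, hi⟩ ⟨i, by omega⟩ rfl
    rw [barrier]
    split_ifs with h0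
    · subst h0; rw [zero_add] at e1 e2 ⊢; omega
    · have h2 := hvu.2 ⟨i - 1, by omega⟩ ⟨i, hi⟩ (by simp only; omega)
      have e3 : coord v i = v ⟨i - 1, by omega⟩ := by
        rw [coord, dif_pos (by omega)]
      omega
  have hm : coord z (i + 1) ≤ barrier v y y' i →
      (max (coord u' (i + 1)) (coord z (i + 1)) ≤ barrier v y y' i ∨
        coord y' (i + 1) < barrier v y y' i) := by
    intro hz
    rw [barrier] at hz ⊢
    split_ifs at hz ⊢ with h0
    · subst h0; right; rw [zero_add]; omega
    · left
      have e1 : coord u' (i + 1) = u' ⟨i, hi⟩ := coord_succ u' ⟨i, hi⟩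
      have h2 := hvu'.2 ⟨i - 1, by omega⟩ ⟨i, hi⟩ (by simp only; omega)
      have e3 : coord v i = v ⟨i - 1, by omega⟩ := by
        rw [coord, dif_pos (by omega)]
      omega
  have hleft := (hN.geom _ ha).measure_left hq hq1 hux (coord z (i + 1))
  have hprod := hind.measure_inter_preimage_eq_mul
    {a | max (coord u (i + 1)) (min (coord y (i + 1)) (barrier v y y' i) - a) = coord z (i + 1)}
    {b | min (barrier v y y' i) (max (coord u' (i + 1)) (coord z (i + 1)) + b) = coord y' (i + 1)}
    MeasurableSet.of_discrete MeasurableSet.of_discrete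
  rw [ENNReal.ofReal_mul (leftProb_nonneg hq hq1 _ _ _)]
  refine hprod.trans ?_
  refine (congrArg (· * _) hleft).trans ?_
  by_cases hz : coord z (i + 1) ≤ barrier v y y' i
  · exact congrArg _ ((hN.geom _ hb).measure_right hq hq1 (hm hz))
  · have : leftProb q (coord u (i + 1)) (min (coord y (i + 1)) (barrier v y y' i))
        (coord z (i + 1)) = 0 := by
      rw [leftProb, if_neg]
      omega
    simp only [this, ENNReal.ofReal_zero, zero_mul]

/-- The transition probabilities of row `l + 1` given the motion of row `l`. -/
theorem IsNoise.measure_nextRow (hN : IsNoise μ q k ξ) (hq : 0 < q) (hq1 : q < 1)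
    {l : ℕ} (n : ℕ) (hl : l + 1 ≤ k) {v : Fin (l / 2) → ℕ} {u u' : Fin ((l + 1) / 2) → ℕ}
    (z : Fin ((l + 1) / 2) → ℕ) {y : Fin ((l + 2) / 2) → ℕ} (y' : Fin ((l + 2) / 2) → ℕ)
    (huy : Interlaced u y) (hvu : Interlaced v u) (hvu' : Interlaced v u') :
    μ {ω | nextRow l v u u' y (fun i => ξ (2 * n + 1) (l + 1) i ω)
      (fun i => ξ (2 * n + 2) (l + 1) i ω) = (z, y')} =
    ENNReal.ofReal (stepProb q v u u' z y y') := by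
  have hset : {ω | nextRow l v u u' y (fun i => ξ (2 * n + 1) (l + 1) i ω)
      (fun i => ξ (2 * n + 2) (l + 1) i ω) = (z, y')} = ⋂ i ∈ Finset.range ((l + 2) / 2),
      {ω | (ξ (2 * n + 1) (l + 1) (i + 1) ω, ξ (2 * n + 2) (l + 1) (i + 1) ω) ∈
        jumpSet v u u' z y y' i} := by
    ext ω
    simp only [Set.mem_ofPred_eq, nextRow_eq_iff, Set.mem_iInter, Finset.mem_range]
  rw [hset, hN.measure_biInter _ (fun i => {p | p.2.2 = i + 1})]
  · rw [stepProb]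
    have hord := hN.measure_jumpSet_ordinary hq hq1 n hl z y' huy hvu hvu'
    have hprod : ∏ i ∈ Finset.range ((l + 1) / 2),
        μ {ω | (ξ (2 * n + 1) (l + 1) (i + 1) ω, ξ (2 * n + 2) (l + 1) (i + 1) ω) ∈
        jumpSet v u u' z y y' i} = ENNReal.ofReal (∏ i : Fin ((l + 1) / 2),
        leftProb q (u i) (min (coord y (i + 1)) (barrier v y y' i)) (z i) *
        rightProb q (max (u' i) (z i)) (barrier v y y' i) (coord y' (i + 1))) := by
      rw [Finset.prod_congr rfl fun i hi => hord i (Finset.mem_range.1 hi),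
        ← Fin.prod_univ_eq_prod_range (fun i => ENNReal.ofReal
          (leftProb q (coord u (i + 1)) (min (coord y (i + 1)) (barrier v y y' i))
          (coord z (i + 1)) * rightProb q (max (coord u' (i + 1)) (coord z (i + 1)))
          (barrier v y y' i) (coord y' (i + 1)))) ((l + 1) / 2),
        ENNReal.ofReal_prod_of_nonneg fun i _ => mul_nonneg (leftProb_nonneg hq hq1 _ _ _)
          (rightProb_nonneg hq hq1 _ _ _)]
      simp only [coord_succ]
    rcases (by omega : (l + 2) / 2 = (l + 1) / 2 ∨ (l + 2) / 2 = (l + 1) / 2 + 1) with h | h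
    · rw [if_pos h.symm, mul_one, show Finset.range ((l + 2) / 2) = Finset.range ((l + 1) / 2) by
        rw [h], hprod]
    · rw [if_neg (by omega), show Finset.range ((l + 2) / 2) = Finset.range ((l + 1) / 2 + 1) by
        rw [h], Finset.prod_range_succ, hprod, ENNReal.ofReal_mul
        (Finset.prod_nonneg fun i _ => mul_nonneg (leftProb_nonneg hq hq1 _ _ _)
          (rightProb_nonneg hq hq1 _ _ _)), congrArg (coord y) h, congrArg (coord y') h,
        show (l + 2) / 2 - 1 = (l + 1) / 2 by omega]
      congr 1
      have ha : (2 * n + 1, l + 1, (l + 1) / 2 + 1) ∈ JumpIndex k :=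
        ⟨by simp, ⟨by simp, hl⟩, ⟨by simp, by simp only; omega⟩⟩
      have hb : (2 * n + 2, l + 1, (l + 1) / 2 + 1) ∈ JumpIndex k :=
        ⟨by simp, ⟨by simp, hl⟩, ⟨by simp, by simp only; omega⟩⟩
      have hind := hN.indepFun ha hb (by simp)
      simp only [jumpSet, Set.mem_ofPred_eq, lt_irrefl, if_false]
      exact (hN.geom _ ha).measure_refl (hN.geom _ hb) hind hq hq1 (min_le_right _ _) _
  · intro i j hij
    refine Set.disjoint_left.2 fun p hp hp' => hij ?_
    have h1 : p.2.2 = i + 1 := hp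
    have h2 : p.2.2 = j + 1 := hp'
    omega
  · intro i hi
    have ha : (2 * n + 1, l + 1, i + 1) ∈ JumpIndex k :=
      ⟨by simp, ⟨by simp, hl⟩, ⟨by simp, by simp only; omega⟩⟩
    have hb : (2 * n + 2, l + 1, i + 1) ∈ JumpIndex k :=
      ⟨by simp, ⟨by simp, hl⟩, ⟨by simp, by simp only; omega⟩⟩
    exact measurableSet_hist_pair (A := {p | p.2.2 = i + 1}) ha hb rfl rfl
      (jumpSet v u u' z y y' i)

omit mΩ in
/-- The motion of row `l + 1` after time `n`, given that of row `l`, is a function of its jump sizes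
after time `n`. -/
theorem measurableSet_nextRow {l : ℕ} (hl : l + 1 ≤ k) (n : ℕ) (v : Fin (l / 2) → ℕ)
    (u u' : Fin ((l + 1) / 2) → ℕ) (y : Fin ((l + 2) / 2) → ℕ) (w : PairState (l + 1)) :
    MeasurableSet[hist k ξ {p | p.2.1 = l + 1 ∧ 2 * n < p.1}]
      {ω | nextRow l v u u' y (fun i => ξ (2 * n + 1) (l + 1) i ω)
        (fun i => ξ (2 * n + 2) (l + 1) i ω) = w} := by
  have hset : {ω | nextRow l v u u' y (fun i => ξ (2 * n + 1) (l + 1) i ω)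
      (fun i => ξ (2 * n + 2) (l + 1) i ω) = w} = ⋂ i ∈ Finset.range ((l + 2) / 2),
      {ω | (ξ (2 * n + 1) (l + 1) (i + 1) ω, ξ (2 * n + 2) (l + 1) (i + 1) ω) ∈
        jumpSet v u u' w.1 y w.2 i} := by
    ext ω
    rw [show w = (w.1, w.2) from rfl]
    simp only [Set.mem_ofPred_eq, nextRow_eq_iff, Set.mem_iInter, Finset.mem_range]
  rw [hset]
  refine Finset.measurableSet_biInter _ fun i hi => ?_
  have hi' := Finset.mem_range.1 hi
  have ha : (2 * n + 1, l + 1, i + 1) ∈ JumpIndex k :=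
    ⟨by simp, ⟨by simp, hl⟩, ⟨by simp, by simp only; omega⟩⟩
  have hb : (2 * n + 2, l + 1, i + 1) ∈ JumpIndex k :=
    ⟨by simp, ⟨by simp, hl⟩, ⟨by simp, by simp only; omega⟩⟩
  exact measurableSet_hist_pair (A := {p | p.2.1 = l + 1 ∧ 2 * n < p.1}) ha hb
    ⟨rfl, by simp⟩ ⟨rfl, by simp⟩ (jumpSet v u u' w.1 y w.2 i)

end Step

/-! ### The Markov property -/

section Chain

variable {Ω : Type*} {k : ℕ} {ξ : ℕ → ℕ → ℕ → Ω → ℕ}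

/-- The event that the state of row `j` follows `w` up to time `n`. -/
def path (ξ : ℕ → ℕ → ℕ → Ω → ℕ) (j n : ℕ) (w : ℕ → PairState j) : Set Ω :=
  {ω | ∀ m ≤ n, W ξ j m ω = w m}

theorem path_succ (j n : ℕ) (w : ℕ → PairState j) :
    path ξ j (n + 1) w = path ξ j n w ∩ {ω | W ξ j (n + 1) ω = w (n + 1)} := by
  ext ω
  simp only [path, Set.mem_ofPred_eq, Set.mem_inter_iff]
  constructor
  · exact fun h => ⟨fun m hm => h m (by omega), h _ le_rfl⟩
  · rintro ⟨h1, h2⟩ m hm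
    rcases Nat.le_succ_iff.1 hm with h | rfl
    · exact h1 m h
    · exact h2

theorem measurable_W_hist {A : Set (ℕ × ℕ × ℕ)} {j n : ℕ} (hj : j ≤ k)
    (hA : ∀ p : ℕ × ℕ × ℕ, p.2.1 ≤ j → p.1 ≤ 2 * n → p ∈ A) :
    Measurable[hist k ξ A] (W ξ j n) :=
  @measurable_W_of Ω (hist k ξ A) ξ n j fun t l' i h1 h2 h3 h4 h5 h6 =>
    measurable_hist (p := (t, l', i)) ⟨h1, ⟨h3, h4.trans hj⟩, ⟨h5, h6⟩⟩ (hA (t, l', i) h4 h2)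

theorem measurableSet_path_hist {A : Set (ℕ × ℕ × ℕ)} {j n : ℕ} (hj : j ≤ k)
    (hA : ∀ p : ℕ × ℕ × ℕ, p.2.1 ≤ j → p.1 ≤ 2 * n → p ∈ A) (w : ℕ → PairState j) :
    MeasurableSet[hist k ξ A] (path ξ j n w) := by
  have h : path ξ j n w = ⋂ m ∈ Finset.range (n + 1), (W ξ j m) ⁻¹' {w m} := by
    ext ω
    simp [path]
  rw [h]
  refine Finset.measurableSet_biInter _ fun m hm => ?_
  have := Finset.mem_range.1 hm
  exact measurable_W_hist hj (fun p h1 h2 => hA p h1 (by omega)) (measurableSet_singleton _)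

variable [mΩ : MeasurableSpace Ω] {μ : Measure Ω} {q : ℝ}

theorem IsNoise.measurable_W (hN : IsNoise μ q k ξ) {j : ℕ} (hj : j ≤ k) (n : ℕ) :
    Measurable (W ξ j n) :=
  (measurable_W_hist (A := Set.univ) hj fun _ _ _ => trivial).mono (hN.hist_le _) le_rfl

theorem IsNoise.measurableSet_path (hN : IsNoise μ q k ξ) {j : ℕ} (hj : j ≤ k) (n : ℕ)
    (w : ℕ → PairState j) : MeasurableSet (path ξ j n w) :=
  hN.hist_le Set.univ _ (measurableSet_path_hist hj (fun _ _ _ => trivial) w)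

/-- The event that the jumps of row `j + 1` between the times `n` and `n + 1` lead from `w n` to
`w (n + 1)`, when row `j` follows `w'`. -/
def stepEvent (ξ : ℕ → ℕ → ℕ → Ω → ℕ) (j n : ℕ) (w' : ℕ → PairState j)
    (w : ℕ → PairState (j + 1)) : Set Ω :=
  {ω | nextRow j (w' (n + 1)).1 (w' n).2 (w' (n + 1)).2 (w n).2
    (fun i => ξ (2 * n + 1) (j + 1) i ω) (fun i => ξ (2 * n + 2) (j + 1) i ω) = w (n + 1)}

/-- The next step of row `j + 1` is independent of its own past and of the whole path of row `j`. -/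
theorem IsNoise.measure_path_inter_succ (hN : IsNoise μ q k ξ) {j : ℕ} (hj : j + 1 ≤ k)
    {n N : ℕ} (hn : n + 1 ≤ N) (w' : ℕ → PairState j) (w : ℕ → PairState (j + 1)) :
    μ (path ξ j N w' ∩ path ξ (j + 1) (n + 1) w) =
      μ (path ξ j N w' ∩ path ξ (j + 1) n w) * μ (stepEvent ξ j n w' w) := by
  have hset : path ξ j N w' ∩ path ξ (j + 1) (n + 1) w =
      (path ξ j N w' ∩ path ξ (j + 1) n w) ∩ stepEvent ξ j n w' w := by
    rw [path_succ, ← Set.inter_assoc]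
    ext ω
    simp only [Set.mem_inter_iff, and_congr_right_iff]
    rintro ⟨h1, h2⟩
    have e0 := h1 n (by omega)
    have e1 := h1 (n + 1) hn
    have e2 := h2 n le_rfl
    simp only [stepEvent, Set.mem_ofPred_eq]
    rw [← e0, ← e1, ← e2, W, next_eq_nextRow]
    rfl
  have hd : Disjoint {p : ℕ × ℕ × ℕ | p.2.1 ≤ j ∨ (p.2.1 ≤ j + 1 ∧ p.1 ≤ 2 * n)}
      {p | p.2.1 = j + 1 ∧ 2 * n < p.1} := by
    refine Set.disjoint_left.2 fun p hp hp' => ?_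
    simp only [Set.mem_ofPred_eq] at hp hp'
    omega
  rw [hset]
  refine (Indep_iff _ _ μ).1 (hN.indep_hist hd) _ _ ?_ (measurableSet_nextRow hj n _ _ _ _ _)
  exact @MeasurableSet.inter _ (hist k ξ _) _ _
    (measurableSet_path_hist (by omega) (fun p h _ => Or.inl h) w')
    (measurableSet_path_hist hj (fun p h h' => Or.inr ⟨h, h'⟩) w)

/-- Given the past of row `j`, the past of row `j + 1` does not depend on the future of row `j`. -/
theorem IsNoise.exists_measure_path_inter (hN : IsNoise μ q k ξ) {j : ℕ} (hj : j + 1 ≤ k) (n : ℕ)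
    (w' : ℕ → PairState j) (w : ℕ → PairState (j + 1)) :
    ∃ c, ∀ N ≥ n, μ (path ξ j N w' ∩ path ξ (j + 1) n w) = μ (path ξ j N w') * c := by
  induction n with
  | zero =>
    by_cases h : w 0 = (fun _ => 0, fun _ => 0)
    · refine ⟨1, fun N _ => ?_⟩
      have : path ξ (j + 1) 0 w = Set.univ := by
        refine Set.eq_univ_of_forall fun ω m hm => ?_
        obtain rfl : m = 0 := by omega
        rw [h]
        rfl
      rw [this, Set.inter_univ, mul_one]
    · refine ⟨0, fun N _ => ?_⟩
      have : path ξ (j + 1) 0 w = ∅ :=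
        Set.eq_empty_of_forall_notMem fun ω hω => h (hω 0 le_rfl).symm
      rw [this, Set.inter_empty, measure_empty, mul_zero]
  | succ n ih =>
    obtain ⟨c, hc⟩ := ih
    refine ⟨c * μ (stepEvent ξ j n w' w), fun N hNn => ?_⟩
    rw [hN.measure_path_inter_succ hj hNn, hc N (by omega), mul_assoc]

/-- The Markov property of row `j`, in unnormalized form. -/
def RowMarkov (μ : Measure Ω) (q : ℝ) (ξ : ℕ → ℕ → ℕ → Ω → ℕ) (j : ℕ) : Prop :=
  ∀ n w, μ (path ξ j (n + 1) w) = μ (path ξ j n w) * ENNReal.ofReal (kern q j (w n).2 (w (n + 1)))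

theorem tsum_measure_inter_fiber {T : Type*} [Countable T] [MeasurableSpace T]
    [MeasurableSingletonClass T] {f : Ω → T} (hf : Measurable f) {A : Set Ω}
    (hA : MeasurableSet A) : ∑' t, μ (A ∩ {ω | f ω = t}) = μ A := by
  rw [← measure_iUnion]
  · congr 1
    ext ω
    simp
  · intro t t' h
    exact Set.disjoint_left.2 fun ω h1 h2 => h (h1.2.symm.trans h2.2)
  · exact fun t => hA.inter (hf (measurableSet_singleton t))

/-- The joint transition of the rows `j` and `j + 1`, given the position of row `j` and the past of
row `j + 1`. -/
theorem IsNoise.measure_joint_step (hN : IsNoise μ q k ξ) {j : ℕ} (hj : j + 1 ≤ k)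
    (hM : RowMarkov μ q ξ j) (n : ℕ) (w : ℕ → PairState (j + 1)) (u : Fin ((j + 1) / 2) → ℕ)
    (p' : PairState j) :
    μ (path ξ (j + 1) (n + 1) w ∩ {ω | (W ξ j n ω).2 = u} ∩ {ω | W ξ j (n + 1) ω = p'}) =
      μ (path ξ (j + 1) n w ∩ {ω | (W ξ j n ω).2 = u}) * (ENNReal.ofReal (kern q j u p') *
        μ {ω | nextRow j p'.1 u p'.2 (w n).2 (fun i => ξ (2 * n + 1) (j + 1) i ω)
          (fun i => ξ (2 * n + 2) (j + 1) i ω) = w (n + 1)}) := by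
  have hj' : j ≤ k := by omega
  have hf : Measurable fun ω => fun m : Fin (n + 1) => W ξ j m ω :=
    measurable_pi_lambda _ fun m => hN.measurable_W hj' m
  have hmu : MeasurableSet {ω | (W ξ j n ω).2 = u} :=
    (hN.measurable_W hj' n).snd (measurableSet_singleton u)
  have hmp : MeasurableSet {ω | W ξ j (n + 1) ω = p'} :=
    hN.measurable_W hj' (n + 1) (measurableSet_singleton p')
  rw [← tsum_measure_inter_fiber hf (((hN.measurableSet_path hj (n + 1) w).inter hmu).inter hmp),
    ← tsum_measure_inter_fiber hf ((hN.measurableSet_path hj n w).inter hmu),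
    ← ENNReal.tsum_mul_right]
  -- Both sides are decomposed over the paths `π` of row `j`, of which the past of row `j + 1` makes
  -- the next step independent.
  refine tsum_congr fun π => ?_
  set w' : ℕ → PairState j := fun m => if h : m < n + 1 then π ⟨m, h⟩ else p' with hw'
  have hfib : {ω | (fun m : Fin (n + 1) => W ξ j m ω) = π} = path ξ j n w' := by
    ext ω
    simp only [Set.mem_ofPred_eq, path, funext_iff, hw']
    constructor
    · intro h m hm
      rw [dif_pos (by omega)]
      exact h ⟨m, by omega⟩
    · intro h m
      have := h m (by omega)
      rwa [dif_pos m.2] at this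
  have hwn1 : w' (n + 1) = p' := dif_neg (by omega)
  rw [hfib]
  by_cases hu : (w' n).2 = u
  · have h1 : path ξ (j + 1) (n + 1) w ∩ {ω | (W ξ j n ω).2 = u} ∩ {ω | W ξ j (n + 1) ω = p'} ∩
        path ξ j n w' = path ξ j (n + 1) w' ∩ path ξ (j + 1) (n + 1) w := by
      rw [path_succ j, hwn1]
      ext ω
      simp only [Set.mem_inter_iff, Set.mem_ofPred_eq]
      constructor
      · rintro ⟨⟨⟨h1, -⟩, h3⟩, h4⟩
        exact ⟨⟨h4, h3⟩, h1⟩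
      · rintro ⟨⟨h4, h3⟩, h1⟩
        exact ⟨⟨⟨h1, by rw [h4 n le_rfl, hu]⟩, h3⟩, h4⟩
    have h2 : path ξ (j + 1) n w ∩ {ω | (W ξ j n ω).2 = u} ∩ path ξ j n w' =
        path ξ j n w' ∩ path ξ (j + 1) n w := by
      ext ω
      simp only [Set.mem_inter_iff, Set.mem_ofPred_eq]
      constructor
      · rintro ⟨⟨h1, -⟩, h4⟩
        exact ⟨h4, h1⟩
      · rintro ⟨h4, h1⟩
        exact ⟨⟨h1, by rw [h4 n le_rfl, hu]⟩, h4⟩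
    obtain ⟨c, hc⟩ := hN.exists_measure_path_inter hj n w' w
    rw [h1, h2, hN.measure_path_inter_succ hj le_rfl, hc (n + 1) (by omega), hc n le_rfl, hM n w',
      hwn1, hu, stepEvent, hwn1, hu]
    ring
  · have h0 : ∀ B : Set Ω, B ∩ {ω | (W ξ j n ω).2 = u} ∩ path ξ j n w' = ∅ := by
      refine fun B => Set.eq_empty_of_forall_notMem ?_
      rintro ω ⟨⟨-, h1⟩, h2⟩
      have h1' : (W ξ j n ω).2 = u := h1
      rw [h2 n le_rfl] at h1'
      exact hu h1'
    rw [Set.inter_right_comm _ _ (path ξ j n w'), h0, h0, Set.empty_inter, measure_empty, zero_mul]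

variable [IsProbabilityMeasure μ]

/-- `stepProb` is the law of the next state for interlacing rows only; for other ones, the factors
in front of it vanish. -/
theorem IsNoise.link_mul_kern_mul_measure (hN : IsNoise μ q k ξ) (hq : 0 < q) (hq1 : q < 1)
    {j : ℕ} (hj : j + 1 ≤ k) (n : ℕ) (u u' : Fin ((j + 1) / 2) → ℕ) (v : Fin (j / 2) → ℕ)
    (y : Fin ((j + 2) / 2) → ℕ) (p' : PairState (j + 1)) :
    ENNReal.ofReal (link j y u) * (ENNReal.ofReal (kern q j u (v, u')) *
      μ {ω | nextRow j v u u' y (fun i => ξ (2 * n + 1) (j + 1) i ω)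
          (fun i => ξ (2 * n + 2) (j + 1) i ω) = p'}) =
    ENNReal.ofReal (link j y u) * (ENNReal.ofReal (kern q j u (v, u')) *
      ENNReal.ofReal (stepProb q v u u' p'.1 y p'.2)) := by
  by_cases huy : Interlaced u y
  · by_cases h : rowKernel q v u u' = 0
    · simp [kern, h]
    · obtain ⟨h1, h2⟩ := interlaced_of_rowKernel_ne_zero h
      rw [← hN.measure_nextRow hq hq1 n hj p'.1 p'.2 huy h1 h2]
  · simp [link, huy]

/-- If row `j` is conditionally distributed as in a uniform pattern at time `n`, then one step of
the dynamics is given by the intertwining. -/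
theorem IsNoise.measure_path_succ_inter (hN : IsNoise μ q k ξ) (hq : 0 < q) (hq1 : q < 1) {j : ℕ}
    (hj : j + 1 ≤ k) (hM : RowMarkov μ q ξ j) (n : ℕ) (w : ℕ → PairState (j + 1))
    (hB : ∀ u, μ (path ξ (j + 1) n w ∩ {ω | (W ξ j n ω).2 = u}) =
      μ (path ξ (j + 1) n w) * ENNReal.ofReal (link j (w n).2 u)) (u' : Fin ((j + 1) / 2) → ℕ) :
    μ (path ξ (j + 1) (n + 1) w ∩ {ω | (W ξ j (n + 1) ω).2 = u'}) =
      μ (path ξ (j + 1) n w) * (ENNReal.ofReal (kern q (j + 1) (w n).2 (w (n + 1))) *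
        ENNReal.ofReal (link j (w (n + 1)).2 u')) := by
  have hj' : j ≤ k := by omega
  have hmp := hN.measurableSet_path hj (n + 1) w
  have hm1 := (hN.measurable_W hj' (n + 1)).fst
  have hmu : MeasurableSet {ω | (W ξ j (n + 1) ω).2 = u'} :=
    (hN.measurable_W hj' (n + 1)).snd (measurableSet_singleton u')
  have hm0 := (hN.measurable_W hj' n).snd
  have hint := intertwining hq hq1 j u' (w (n + 1)).1 (w n).2 (w (n + 1)).2
  rw [← tsum_measure_inter_fiber hm0 (hmp.inter hmu)]
  rw [show (w (n + 1)) = ((w (n + 1)).1, (w (n + 1)).2) from rfl, ← hint, ← ENNReal.tsum_mul_left]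
  refine tsum_congr fun u => ?_
  have hmu0 : MeasurableSet {ω | (W ξ j n ω).2 = u} := hm0 (measurableSet_singleton u)
  rw [← tsum_measure_inter_fiber hm1 ((hmp.inter hmu).inter hmu0),
    ← ENNReal.tsum_mul_left]
  refine tsum_congr fun v => ?_
  rw [← hN.link_mul_kern_mul_measure hq hq1 hj n u u' v (w n).2 (w (n + 1)), ← mul_assoc, ← hB u,
    ← hN.measure_joint_step hj hM n w u (v, u')]
  congr 1
  ext ω
  simp only [Set.mem_inter_iff, Set.mem_ofPred_eq, Prod.ext_iff]
  tauto

/-- Initially all particles are at `0`, which is the only pattern with last row `0`. -/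
theorem link_zero (j : ℕ) (u : Fin ((j + 1) / 2) → ℕ) :
    ENNReal.ofReal (link j (fun _ => 0) u) = if u = fun _ => 0 then 1 else 0 := by
  have h0 : ∀ u, u ≠ (fun _ => 0) → ENNReal.ofReal (link j (fun _ => 0) u) = 0 := by
    intro u hu
    rw [link, if_neg, ENNReal.ofReal_zero]
    intro h
    apply hu
    funext i
    exact Nat.le_zero.1 (h.1 i ⟨i, by omega⟩ rfl)
  split_ifs with h
  · have := sum_link (k := j) (y := fun _ => 0) (count_pos (j + 1) _ fun _ _ _ => le_rfl).ne'
    rw [tsum_eq_single _ h0] at this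
    rw [h, this]
  · exact h0 u h

/-- The conditional law of row `j` given the past of row `j + 1` is that of a uniform pattern, and
row `j + 1` is Markov. -/
theorem IsNoise.measure_path_inter_eq (hN : IsNoise μ q k ξ) (hq : 0 < q) (hq1 : q < 1) {j : ℕ}
    (hj : j + 1 ≤ k) (hM : RowMarkov μ q ξ j) (n : ℕ) (w : ℕ → PairState (j + 1)) :
    (∀ u, μ (path ξ (j + 1) n w ∩ {ω | (W ξ j n ω).2 = u}) =
      μ (path ξ (j + 1) n w) * ENNReal.ofReal (link j (w n).2 u)) ∧
    μ (path ξ (j + 1) (n + 1) w) =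
      μ (path ξ (j + 1) n w) * ENNReal.ofReal (kern q (j + 1) (w n).2 (w (n + 1))) := by
  -- The second statement follows from the first by summing over the position of row `j`.
  have hstep : ∀ n, (∀ u, μ (path ξ (j + 1) n w ∩ {ω | (W ξ j n ω).2 = u}) =
      μ (path ξ (j + 1) n w) * ENNReal.ofReal (link j (w n).2 u)) →
      μ (path ξ (j + 1) (n + 1) w) =
        μ (path ξ (j + 1) n w) * ENNReal.ofReal (kern q (j + 1) (w n).2 (w (n + 1))) := by
    intro n hB
    rw [← tsum_measure_inter_fiber (hN.measurable_W (by omega : j ≤ k) (n + 1)).snd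
      (hN.measurableSet_path hj (n + 1) w)]
    simp only [hN.measure_path_succ_inter hq hq1 hj hM n w hB, ENNReal.tsum_mul_left]
    by_cases hc : count (j + 1) (w (n + 1)).2 = 0
    · simp [kern, hc]
    · rw [sum_link hc, mul_one]
  refine ⟨?_, hstep n ?_⟩ <;>
  · induction n with
    | zero =>
      intro u
      by_cases h : w 0 = (fun _ => 0, fun _ => 0)
      · rw [h, link_zero]
        split_ifs with hu
        · have : {ω | (W ξ j 0 ω).2 = u} = Set.univ := Set.eq_univ_of_forall fun ω => hu.symm
          rw [this, Set.inter_univ, mul_one]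
        · have : {ω | (W ξ j 0 ω).2 = u} = ∅ :=
            Set.eq_empty_of_forall_notMem fun ω hω => hu (Eq.symm hω)
          rw [this, Set.inter_empty, measure_empty, mul_zero]
      · have : path ξ (j + 1) 0 w = ∅ :=
          Set.eq_empty_of_forall_notMem fun ω hω => h (hω 0 le_rfl).symm
        rw [this, Set.empty_inter, measure_empty, zero_mul]
    | succ n ih =>
      intro u'
      rw [hN.measure_path_succ_inter hq hq1 hj hM n w ih, hstep n ih, mul_assoc]

/-- Row `0` is empty and has a single state. -/
theorem kern_zero (y : Fin ((0 + 1) / 2) → ℕ) (p' : PairState 0) : kern q 0 y p' = 1 := by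
  have h : ∀ y, (count 0 y : ℝ) ≠ 0 := fun y => by
    exact_mod_cast (count_pos 0 y fun i => Fin.elim0 i).ne'
  have hy : p'.2 = y := funext fun i => Fin.elim0 i
  rw [kern, hy, div_self (h y), rowKernel, if_pos ⟨⟨fun i => Fin.elim0 i, fun i => Fin.elim0 i⟩,
    ⟨fun i => Fin.elim0 i, fun i => Fin.elim0 i⟩⟩]
  simp

/-- Each row is Markov, by induction over the rows from the empty row `0`. -/
theorem IsNoise.rowMarkov (hN : IsNoise μ q k ξ) (hq : 0 < q) (hq1 : q < 1) {j : ℕ} (hj : j ≤ k) :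
    RowMarkov μ q ξ j := by
  induction j with
  | zero =>
    intro n w
    have : ∀ n, path ξ 0 n w = Set.univ := fun n => Set.eq_univ_of_forall fun ω m _ =>
      Prod.ext (funext fun i => Fin.elim0 i) (funext fun i => Fin.elim0 i)
    rw [this, this, kern_zero, ENNReal.ofReal_one, mul_one]
  | succ j ih =>
    exact fun n w => (hN.measure_path_inter_eq hq hq1 hj (ih (by omega)) n w).2

/-- The kernel `S_j` has total mass `1`, because the motion of a row given the previous one is a
probability law; the first step of the dynamics serves to express the latter. -/
theorem IsNoise.tsum_kern (hN : IsNoise μ q k ξ) (hq : 0 < q) (hq1 : q < 1) {j : ℕ} (hj : j ≤ k)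
    (y : Fin ((j + 1) / 2) → ℕ) (hy : count j y ≠ 0) :
    ∑' p', ENNReal.ofReal (kern q j y p') = 1 := by
  induction j with
  | zero =>
    have : Unique (PairState 0) := ⟨⟨(fun i => Fin.elim0 i, fun i => Fin.elim0 i)⟩, fun p =>
      Prod.ext (funext fun i => Fin.elim0 i) (funext fun i => Fin.elim0 i)⟩
    simp [tsum_fintype, kern_zero]
  | succ j ih =>
    have h1 : ∀ p' : PairState (j + 1), ENNReal.ofReal (kern q (j + 1) y p') =
        ∑' u' : Fin ((j + 1) / 2) → ℕ, ∑' u, ∑' v : Fin (j / 2) → ℕ, ENNReal.ofReal (link j y u) *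
          (ENNReal.ofReal (kern q j u (v, u')) *
          μ {ω | nextRow j v u u' y (fun i => ξ (2 * 0 + 1) (j + 1) i ω)
          (fun i => ξ (2 * 0 + 2) (j + 1) i ω) = p'}) := by
      intro p'
      simp only [hN.link_mul_kern_mul_measure hq hq1 hj]
      rw [tsum_congr fun u' => intertwining hq hq1 j u' p'.1 y p'.2, ENNReal.tsum_mul_left]
      by_cases hc : count (j + 1) p'.2 = 0
      · simp [kern, hc]
      · rw [sum_link hc, mul_one]
    -- Summing over the next state of row `j + 1` first, then over that of row `j`.
    have h2 : ∀ u u' v, ∑' p' : PairState (j + 1), μ {ω | nextRow j v u u' y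
        (fun i => ξ (2 * 0 + 1) (j + 1) i ω) (fun i => ξ (2 * 0 + 2) (j + 1) i ω) = p'} = 1 := by
      intro u u' v
      have hm : Measurable fun ω => nextRow j v u u' y
          (fun i => ξ (2 * 0 + 1) (j + 1) i ω) (fun i => ξ (2 * 0 + 2) (j + 1) i ω) :=
        measurable_to_countable' fun p' => hN.hist_le _ _ (measurableSet_nextRow hj 0 v u u' y p')
      have := tsum_measure_inter_fiber (μ := μ) hm MeasurableSet.univ
      simpa only [Set.univ_inter, measure_univ] using this
    simp only [h1]
    rw [ENNReal.tsum_comm]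
    have h3 : ∀ u' : Fin ((j + 1) / 2) → ℕ, ∑' p' : PairState (j + 1), ∑' u,
        ∑' v : Fin (j / 2) → ℕ, ENNReal.ofReal (link j y u) * (ENNReal.ofReal (kern q j u (v, u')) *
          μ {ω | nextRow j v u u' y (fun i => ξ (2 * 0 + 1) (j + 1) i ω)
          (fun i => ξ (2 * 0 + 2) (j + 1) i ω) = p'}) =
        ∑' u, ENNReal.ofReal (link j y u) *
          ∑' v : Fin (j / 2) → ℕ, ENNReal.ofReal (kern q j u (v, u')) := by
      intro u'
      rw [ENNReal.tsum_comm]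
      refine tsum_congr fun u => ?_
      rw [ENNReal.tsum_comm, ← ENNReal.tsum_mul_left]
      refine tsum_congr fun v => ?_
      rw [ENNReal.tsum_mul_left, ENNReal.tsum_mul_left, h2, mul_one]
    simp only [h3]
    rw [ENNReal.tsum_comm, ← sum_link hy]
    refine tsum_congr fun u => ?_
    rw [ENNReal.tsum_mul_left]
    by_cases hu : count j u = 0
    · simp [link, hu]
    · have := ih (by omega) u hu
      rw [ENNReal.tsum_prod', ENNReal.tsum_comm] at this
      rw [this, mul_one]

end Chain

end OrthGT

end

theorem mainTheorem2
    {Ω : Type*} [MeasurableSpace Ω] (μ : MeasureTheory.Measure Ω)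
    [MeasureTheory.IsProbabilityMeasure μ]
    (q : ℝ) (hq0 : 0 < q) (hq1 : q < 1) (k : ℕ) (hk : 1 ≤ k)
    (ξ : ℕ → ℕ → ℕ → Ω → ℕ)
    (hmeas : ∀ p ∈ OrthGT.JumpIndex k, Measurable (ξ p.1 p.2.1 p.2.2))
    (hgeom : ∀ p ∈ OrthGT.JumpIndex k, ∀ m : ℕ,
      μ {ω | ξ p.1 p.2.1 p.2.2 ω = m} = ENNReal.ofReal (q ^ m * (1 - q)))
    (hindep : ProbabilityTheory.iIndepFun
      (fun p : OrthGT.JumpIndex k => ξ p.val.1 p.val.2.1 p.val.2.2) μ) :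
    OrthGT.IsMarkovKernelOn (OrthGT.WplusPair k) (OrthGT.S q k) ∧
      OrthGT.IsMarkovChainFromOne μ (OrthGT.WplusPair k) (OrthGT.S q k)
        (fun n ω => (OrthGT.Z (fun t l i => ξ t l i ω) k n,
          OrthGT.Y (fun t l i => ξ t l i ω) k n)) := by
  have hN : OrthGT.IsNoise μ q k ξ := ⟨fun p hp => ⟨hmeas p hp, hgeom p hp⟩, hindep⟩
  refine ⟨fun p hp => ⟨fun p' _ => ?_, ?_⟩, fun n hn ω => ?_, fun n hn w hw hne => ?_⟩
  · rw [OrthGT.S_eq_kern hq0 hk]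
    exact OrthGT.kern_nonneg hq0 hq1 _ _ _
  · have hsum := hN.tsum_kern hq0 hq1 le_rfl p.2 (OrthGT.count_pos k p.2 hp.2.1).ne'
    -- The kernel charges only states of `𝒲⁺_{k,k+1}`.
    have hsupp : Function.support (fun p' => ENNReal.ofReal (OrthGT.kern q k p.2 p')) ⊆
        OrthGT.WplusPair k := by
      intro p' hp'
      apply OrthGT.mem_WplusPair_of_interlaced
      refine (OrthGT.interlaced_of_rowKernel_ne_zero (q := q) (y := p.2) fun h => hp' ?_).2
      simp [OrthGT.kern, h]
    rw [← tsum_subtype_eq_of_support_subset hsupp] at hsum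
    have h := ENNReal.hasSum_toReal (hsum.trans_ne ENNReal.one_ne_top)
    rw [← ENNReal.tsum_toReal_eq fun _ => ENNReal.ofReal_ne_top, hsum, ENNReal.toReal_one] at h
    simp only [ENNReal.toReal_ofReal (OrthGT.kern_nonneg hq0 hq1 _ _ _)] at h
    simpa only [OrthGT.S_eq_kern hq0 hk] using h
  · obtain ⟨n, rfl⟩ : ∃ m, n = m + 1 := ⟨n - 1, by omega⟩
    exact OrthGT.state_mem _ k n
  -- The path events include the time `0`, at which the state is deterministic.
  · set w' : ℕ → OrthGT.PairState k := fun m => if m = 0 then (fun _ => 0, fun _ => 0) else w m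
      with hw'
    have hpath : ∀ n, {ω | ∀ m, 1 ≤ m → m ≤ n → (OrthGT.Z (fun t l i => ξ t l i ω) k m,
        OrthGT.Y (fun t l i => ξ t l i ω) k m) = w m} = OrthGT.path ξ k n w' := by
      intro n
      ext ω
      simp only [OrthGT.path, Set.mem_ofPred_eq, hw']
      constructor
      · intro h m hm
        split_ifs with h0
        · subst h0
          rfl
        · exact h m (by omega) hm
      · intro h m h1 hm
        have := h m hm
        rwa [if_neg (by omega)] at this
    have hn0 : w' n = w n := if_neg (by omega)
    have hn1 : w' (n + 1) = w (n + 1) := if_neg (by omega)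
    simp only [hpath] at hne ⊢
    rw [ProbabilityTheory.cond_apply (hN.measurableSet_path le_rfl n w')]
    have hstep := hN.rowMarkov hq0 hq1 le_rfl n w'
    rw [OrthGT.path_succ, hn0, hn1] at hstep
    rw [OrthGT.S_eq_kern hq0 hk]
    refine (congrArg (_ * ·) hstep).trans ?_
    rw [← mul_assoc, ENNReal.inv_mul_cancel hne (MeasureTheory.measure_ne_top μ _), one_mul]
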